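/- Let $G$ be a connected unimodular (finite-dimensional, real) Lie group, let $\Lambda$ be a lattice in $G$, let $X=G/\Lambda$, and let $m_X$ be the unique $G$-invariant Borel probability measure on $X$. Let $\mu$ be a compactly supported Borel probability measure on $G$, let $E=\operatorname{supp}\mu$, and let $\Gamma$ be the subgroup of $G$ generated by $E$. Put $B=E^{\mathbb N}$ and $\bar B=E^{\mathbb Z}$, with the Bernoulli measures $\beta=\mu^{\otimes\mathbb N}$ and $\bar\beta=\mu^{\otimes\mathbb Z}$, and let $T:\bar B\to\bar B$, $(Tb)_i=b_{i+1}$, be the shift. For a sequence $b$ write $g_{b_1^n}=b_n b_{n-1}\cdots b_1\in\Gamma$ (with $g_{b_1^0}=1$). A sequence $(z_n)_{n\ge 0}$ in a space $Z$ is called equidistributed with respect to a probability measure $m$ on $Z$ if $\frac1N\sum_{n=0}^{N-1}\varphi(z_n)\to\int_Z\varphi\,dm$ as $N\to\infty$ for every bounded continuous function $\varphi:Z\to\mathbb R$. Fix $x\in X$ and suppose that for $\beta$-a.e. $b\in B$ the sequence $(g_{b_1^n}x)_{n}$ is equidistributed with respect to $m_X$. Let $K$ be a compact Hausdorff group with Haar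 probability measure $m_K$, and let $\kappa:\Gamma\to K$ be a homomorphism whose restriction to $E$ (with the topology induced from $G$) is continuous, such that the $\Gamma$-action $\gamma(x',k)=(\gamma x',\kappa(\gamma)k)$ on $X\times K$ is ergodic with respect to $m_X\otimes m_K$. Let $Y$ be a locally compact metric space, let $f:\bar B\to Y$ be a Borel measurable map, and let $m_Y=f_*\bar\beta$. Then for $\bar\beta$-a.e. $b\in\bar B$ the sequence $$\big(g_{b_1^n}x,\ \kappa(g_{b_1^n}),\ f(T^n b)\big)_{n}$$ is equidistributed with respect to $m_X\otimes m_K\otimes m_Y$ on $X\times K\times Y$. -/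

import Mathlib

open MeasureTheory Filter Topology
open scoped Manifold ContDiff BoundedContinuousFunction

namespace RandomWalk

/-- The sequence `u` is equidistributed with respect to `m`: the sampling measures
`N⁻¹ ∑_{n < N} δ_{u n}` converge weakly to `m`. -/
def Equidistributed {Z : Type*} [TopologicalSpace Z] [MeasurableSpace Z]
    (u : ℕ → Z) (m : Measure Z) : Prop :=
  ∀ φ : Z →ᵇ ℝ,
    Tendsto (fun N : ℕ => (N : ℝ)⁻¹ * ∑ n ∈ Finset.range N, φ (u n)) atTop (𝓝 (∫ z, φ z ∂m))

section Group

variable {G : Type*} [Group G] [TopologicalSpace G] [MeasurableSpace G]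

/-- Every Haar measure (they are left invariant) is also right invariant. -/
def IsUnimodular (G : Type*) [Group G] [TopologicalSpace G] [MeasurableSpace G] : Prop :=
  ∀ ν : Measure G, ν.IsHaarMeasure → ν.IsMulRightInvariant

/-- A lattice: a discrete subgroup `Λ` such that `G ⧸ Λ` carries a `G`-invariant
probability measure. -/
def IsLattice (Λ : Subgroup G) : Prop :=
  DiscreteTopology Λ ∧
    ∃ ν : Measure (G ⧸ Λ), IsProbabilityMeasure ν ∧ SMulInvariantMeasure G (G ⧸ Λ) ν

/-- The alphabet `E = supp μ`. -/
abbrev Alphabet (μ : Measure G) : Type _ := ↥μ.support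

/-- The subgroup `Γ` generated by `E = supp μ`. -/
abbrev walkGroup (μ : Measure G) : Subgroup G := Subgroup.closure μ.support

/-- The inclusion `e ↦ g_e` of `E` into `Γ`. -/
def letter (μ : Measure G) (e : Alphabet μ) : walkGroup μ :=
  ⟨e.1, Subgroup.subset_closure e.2⟩

/-- The measure `μ`, viewed as a measure on `E = supp μ`. -/
noncomputable def alphabetMeasure (μ : Measure G) : Measure (Alphabet μ) :=
  μ.comap Subtype.val

instance alphabetMeasure_isProbabilityMeasure [OpensMeasurableSpace G]
    [SecondCountableTopology G] (μ : Measure G) [IsProbabilityMeasure μ] :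
    IsProbabilityMeasure (alphabetMeasure μ) := by
  constructor
  have hm : MeasurableSet μ.support := (Measure.isClosed_support (μ := μ)).measurableSet
  rw [alphabetMeasure, (MeasurableEmbedding.subtype_coe hm).comap_apply, Set.image_univ,
    Subtype.range_coe]
  exact (prob_compl_eq_zero_iff hm).1 Measure.measure_compl_support

/-- The Bernoulli measure `β = μ^{⊗ ℕ}` on `B = E^ℕ`. A point `(b₁, b₂, …)` of `B` is the
function `b : ℕ → E` with `b i = b_{i+1}`. -/
noncomputable def bernoulli [OpensMeasurableSpace G] [SecondCountableTopology G]
    (μ : Measure G) [IsProbabilityMeasure μ] : Measure (ℕ → Alphabet μ) :=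
  Measure.infinitePi fun _ => alphabetMeasure μ

/-- The Bernoulli measure `μ^{⊗ ℤ}` on `E^ℤ`. -/
noncomputable def biBernoulli [OpensMeasurableSpace G] [SecondCountableTopology G]
    (μ : Measure G) [IsProbabilityMeasure μ] : Measure (ℤ → Alphabet μ) :=
  Measure.infinitePi fun _ => alphabetMeasure μ

/-- The product `g_{b_n} ⋯ g_{b_1}` in `Γ` (with `b i` standing for `b_{i+1}`);
the newest factor is on the left. -/
def walk (μ : Measure G) (b : ℕ → Alphabet μ) : ℕ → walkGroup μ
  | 0 => 1
  | n + 1 => letter μ (b n) * walk μ b n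

/-- The one-sided sequence `(b₁, b₂, …)` of a two-sided sequence `b`, in the indexing of `walk`. -/
def future {E : Type*} (b : ℤ → E) : ℕ → E := fun i => b ((i : ℤ) + 1)

/-- The shift map on two-sided sequences. -/
def shift {E : Type*} (b : ℤ → E) : ℤ → E := fun i => b (i + 1)

end Group

/-- The skew action `γ (x, k) = (γ x, κ(γ) k)` of a subgroup `Γ` of `G` on `X × K`. -/
abbrev skewAction {G X K : Type*} [Group G] [MulAction G X] [Group K] {Γ : Subgroup G}
    (κ : Γ →* K) : MulAction Γ (X × K) where
  smul γ z := ((γ : G) • z.1, κ γ * z.2)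
  one_smul z := by
    change (((1 : Γ) : G) • z.1, κ 1 * z.2) = z
    simp
  mul_smul γ γ' z := by
    change (((γ * γ' : Γ) : G) • z.1, κ (γ * γ') * z.2) =
      ((γ : G) • ((γ' : G) • z.1), κ γ * (κ γ' * z.2))
    simp [mul_smul, mul_assoc]

end RandomWalk

/-!
The proof replaces the group walk by the following data: a compact alphabet `E` with a probability
measure `ν`, continuous maps `act e : X → X`, and a continuous `τ : E → K`; a sequence of letters
drives `(x, k)` by `extAct act τ e (x, k) = (act e x, τ e * k)`. The averages are compared in three
stages.

*Adding the future.* If almost every trajectory `xₙ` is equidistributed on `X`, then almost every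
sequence `(xₙ, (bₙ, bₙ₊₁, …))` is equidistributed for the product of `mX` and the Bernoulli measure
(`ae_equidistributed_orbit_future`). Given the position `xₙ`, the next letters are a fresh
independent sample, so a function of `xₙ` and `p` letters may be replaced by its mean over the
letters, by a law of large numbers for variables with finite range of dependence
(`ae_tendsto_cesaro_zero`).

*Lifting to the compact extension.* Ergodicity of `Γ` on `X × K` gives ergodicity of the skew
product `(b, z) ↦ (σ b, b₀ z)` (`ergodic_skew`, `ergodic_skew_letter`); the continuity of `κ` on the
support makes a set that is invariant under almost every letter invariant under all of them. By the
mean ergodic theorem, averages of a continuous function `H` over blocks of length `L` are close to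
`∫ H` in mean. Right translations of `K` commute with the walk and `H` is equicontinuous along
them, so at a given point the deviation of a block average is bounded by its mean over the fibre
`K`. That mean is a continuous function on the base, where equidistribution with the future
applies; no countable family of test functions on `K` is needed, and `K` need not be metrizable
(`tendsto_cesaro_skew_of_equidistributed`).

*Adding a measurable factor.* A continuous function of the two-sided sequence depends, up to `ε`, on
finitely many letters, and after a shift in time on future letters only. For a measurable `f` one
uses compact sets `C j ⊆ E^ℤ` on which `f` is continuous and whose complements have measure at most
`4⁻ʲ`. By the maximal ergodic inequality, almost every orbit visits the complement of `C j` with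
frequency at most `2⁻ʲ`, at all times and for all large `j`
(`ae_eventually_forall_cesaro_indicator_le`), so `f` may be treated as continuous. The exceptional
null set of this stage depends on `f` alone and not on test functions, so that `Y` need not be
separable; the compact sets come from a form of Lusin's theorem valid for all metric targets
(`exists_isCompact_continuousOn`), which rests on there being only continuum many Borel sets in a
Polish space. A test function on `X × K × Y` is finally approximated on compact sets by finite sums
of products (`exists_finset_abs_sub_sum_le`).
-/

namespace RandomWalk

/-! ### Cesàro averages -/

section Cesaro

/-- The Cesàro average `N⁻¹ ∑_{n < N} a n`; it is `0` for `N = 0`. -/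
noncomputable def cesaro (a : ℕ → ℝ) (N : ℕ) : ℝ := (N : ℝ)⁻¹ * ∑ n ∈ Finset.range N, a n

lemma cesaro_add (a b : ℕ → ℝ) (N : ℕ) :
    cesaro (fun n => a n + b n) N = cesaro a N + cesaro b N := by
  simp [cesaro, Finset.sum_add_distrib, mul_add]

lemma cesaro_sub (a b : ℕ → ℝ) (N : ℕ) :
    cesaro (fun n => a n - b n) N = cesaro a N - cesaro b N := by
  simp [cesaro, Finset.sum_sub_distrib, mul_sub]

lemma cesaro_const_mul (c : ℝ) (a : ℕ → ℝ) (N : ℕ) :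
    cesaro (fun n => c * a n) N = c * cesaro a N := by
  simp only [cesaro, ← Finset.mul_sum]; ring

lemma cesaro_sum {ι : Type*} (s : Finset ι) (a : ι → ℕ → ℝ) (N : ℕ) :
    cesaro (fun n => ∑ i ∈ s, a i n) N = ∑ i ∈ s, cesaro (a i) N := by
  simp only [cesaro]
  rw [Finset.sum_comm, Finset.mul_sum]

lemma cesaro_const (c : ℝ) {N : ℕ} (hN : N ≠ 0) : cesaro (fun _ => c) N = c := by
  have : (N : ℝ) ≠ 0 := by exact_mod_cast hN
  simp [cesaro, this]

lemma tendsto_cesaro_const (c : ℝ) : Tendsto (cesaro fun _ => c) atTop (𝓝 c) :=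
  tendsto_const_nhds.congr' <| (eventually_ne_atTop 0).mono fun _ h => (cesaro_const c h).symm

lemma cesaro_mono {a b : ℕ → ℝ} (h : ∀ n, a n ≤ b n) (N : ℕ) : cesaro a N ≤ cesaro b N :=
  mul_le_mul_of_nonneg_left (Finset.sum_le_sum fun n _ => h n) (by positivity)

lemma abs_cesaro_sub_le {a b r : ℕ → ℝ} (h : ∀ n, |a n - b n| ≤ r n) (N : ℕ) :
    |cesaro a N - cesaro b N| ≤ cesaro r N := by
  rw [← cesaro_sub, cesaro, abs_mul, abs_of_nonneg (by positivity : (0 : ℝ) ≤ (N : ℝ)⁻¹)]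
  exact mul_le_mul_of_nonneg_left
    ((Finset.abs_sum_le_sum_abs _ _).trans (Finset.sum_le_sum fun n _ => h n)) (by positivity)

lemma tendsto_cesaro_shift {a : ℕ → ℝ} {M : ℝ} (hM : ∀ n, |a n| ≤ M) (l : ℕ) :
    Tendsto (fun N => cesaro a N - cesaro (fun n => a (n + l)) N) atTop (𝓝 0) := by
  have key : ∀ N : ℕ, |cesaro a N - cesaro (fun n => a (n + l)) N| ≤ 2 * l * M / N := by
    intro N
    have h1 : ∑ n ∈ Finset.range N, a n - ∑ n ∈ Finset.range N, a (n + l)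
        = ∑ n ∈ Finset.range l, a n - ∑ n ∈ Finset.range l, a (N + n) := by
      have e1 := Finset.sum_range_add a N l
      have e2 := Finset.sum_range_add a l N
      rw [add_comm l N] at e2
      have e3 : ∑ n ∈ Finset.range N, a (n + l) = ∑ n ∈ Finset.range N, a (l + n) :=
        Finset.sum_congr rfl fun n _ => by rw [add_comm]
      rw [e3]; linarith
    have h2 : ∀ c : ℕ → ℕ, |∑ n ∈ Finset.range l, a (c n)| ≤ l * M := fun c => by
      refine (Finset.abs_sum_le_sum_abs _ _).trans
        ((Finset.sum_le_sum fun n _ => hM (c n)).trans (by simp))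
    rw [cesaro, cesaro, ← mul_sub, h1, abs_mul, abs_of_nonneg (by positivity), div_eq_inv_mul]
    refine mul_le_mul_of_nonneg_left ?_ (by positivity)
    have := h2 id
    have := h2 (N + ·)
    refine (abs_sub _ _).trans ?_
    simp only [id] at *
    linarith
  exact squeeze_zero_norm key (tendsto_const_div_atTop_nhds_zero_nat _)

/-- A bounded sequence and the sequence of its averages over blocks of length `L` have the same
asymptotic Cesàro averages. -/
lemma tendsto_cesaro_block {a : ℕ → ℝ} {M : ℝ} (hM : ∀ n, |a n| ≤ M) {L : ℕ} (hL : L ≠ 0) :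
    Tendsto (fun N => cesaro a N - cesaro (fun n => cesaro (fun l => a (n + l)) L) N)
      atTop (𝓝 0) := by
  have h : ∀ N, cesaro a N - cesaro (fun n => cesaro (fun l => a (n + l)) L) N
      = (L : ℝ)⁻¹ * ∑ l ∈ Finset.range L, (cesaro a N - cesaro (fun n => a (n + l)) N) := by
    intro N
    have hL' : (L : ℝ) ≠ 0 := by exact_mod_cast hL
    have e : cesaro (fun n => cesaro (fun l => a (n + l)) L) N
        = (L : ℝ)⁻¹ * ∑ l ∈ Finset.range L, cesaro (fun n => a (n + l)) N := by
      rw [← cesaro_sum, ← cesaro_const_mul]; rfl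
    rw [e, Finset.sum_sub_distrib, mul_sub]
    simp [hL']
  simp_rw [h]
  have := tendsto_finsetSum (Finset.range L) fun l _ => tendsto_cesaro_shift hM l
  simpa using this.const_mul ((L : ℝ)⁻¹)

lemma tendsto_of_forall_approx {u : ℕ → ℝ} {c : ℝ}
    (h : ∀ ε > 0, ∀ᶠ N in atTop, |u N - c| ≤ ε) : Tendsto u atTop (𝓝 c) := by
  rw [Metric.tendsto_nhds]
  intro ε hε
  filter_upwards [h (ε / 2) (half_pos hε)] with N hN
  rw [Real.dist_eq]; linarith

variable {W : Type*} [MeasurableSpace W] {P : Measure W} {φ : W → ℝ}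

/-- On a product of spaces that are not second countable, a continuous function need not be
measurable for the product `σ`-algebra; measurability up to null sets follows from approximation in
mean. -/
lemma aestronglyMeasurable_of_approx
    (h : ∀ ε > 0, ∃ Ψ r : W → ℝ, (∀ x, |φ x - Ψ x| ≤ r x) ∧ Integrable Ψ P ∧ Integrable r P ∧
      ∫ x, r x ∂P ≤ ε) : AEStronglyMeasurable φ P := by
  choose Ψ r h1 h2 h3 h4 using fun n : ℕ => h (1 / ((n : ℝ) + 1)) (by positivity)
  have h0 : ∀ n x, 0 ≤ r n x := fun n x => (abs_nonneg _).trans (h1 n x)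
  have ht : TendstoInMeasure P r atTop (fun _ => (0 : ℝ)) := by
    refine tendstoInMeasure_of_tendsto_eLpNorm (p := 1) one_ne_zero
      (fun n => (h3 n).aestronglyMeasurable) aestronglyMeasurable_const ?_
    have e : ∀ n, eLpNorm (r n - fun _ => (0 : ℝ)) 1 P = ENNReal.ofReal (∫ x, r n x ∂P) := by
      intro n
      have : (r n - fun _ => (0 : ℝ)) = r n := by ext; simp
      rw [this, eLpNorm_one_eq_lintegral_enorm,
        ofReal_integral_eq_lintegral_ofReal (h3 n) (ae_of_all _ (h0 n))]
      exact lintegral_congr fun x => Real.enorm_of_nonneg (h0 n x)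
    simp_rw [e]
    rw [← ENNReal.ofReal_zero]
    refine ENNReal.tendsto_ofReal ?_
    exact squeeze_zero (fun n => integral_nonneg (h0 n)) h4 tendsto_one_div_add_atTop_nhds_zero_nat
  obtain ⟨ns, -, hns⟩ := ht.exists_seq_tendsto_ae
  refine aestronglyMeasurable_of_tendsto_ae atTop
    (f := fun i => Ψ (ns i)) (fun i => (h2 _).aestronglyMeasurable) ?_
  filter_upwards [hns] with x hx
  rw [tendsto_iff_dist_tendsto_zero]
  exact squeeze_zero (fun _ => dist_nonneg)
    (fun i => by rw [dist_comm, Real.dist_eq]; exact h1 (ns i) x) hx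

/-- Approximation principle: a function which is squeezed, up to an error that is small both in mean
and on average along the sequence, by functions whose averages converge, inherits integrability
and the convergence of the averages. -/
theorem tendsto_cesaro_of_approx {w : ℕ → W}
    (h : ∀ ε > 0, ∃ Ψ r : W → ℝ, (∀ x, |φ x - Ψ x| ≤ r x) ∧ Integrable Ψ P ∧ Integrable r P ∧
      Tendsto (cesaro fun n => Ψ (w n)) atTop (𝓝 (∫ x, Ψ x ∂P)) ∧
      (∀ᶠ N in atTop, cesaro (fun n => r (w n)) N ≤ ε) ∧ ∫ x, r x ∂P ≤ ε) :
    Integrable φ P ∧ Tendsto (cesaro fun n => φ (w n)) atTop (𝓝 (∫ x, φ x ∂P)) := by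
  have hm : AEStronglyMeasurable φ P := aestronglyMeasurable_of_approx fun ε hε => by
    obtain ⟨Ψ, r, h1, h2, h3, -, -, h6⟩ := h ε hε
    exact ⟨Ψ, r, h1, h2, h3, h6⟩
  have hi : Integrable φ P := by
    obtain ⟨Ψ, r, h1, h2, h3, -⟩ := h 1 one_pos
    refine (h2.abs.add h3).mono' hm (ae_of_all _ fun x => ?_)
    have := h1 x
    rw [Real.norm_eq_abs]
    simp only [Pi.add_apply]
    linarith [abs_sub_abs_le_abs_sub (φ x) (Ψ x)]
  refine ⟨hi, tendsto_of_forall_approx fun ε hε => ?_⟩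
  obtain ⟨Ψ, r, h1, h2, h3, h4, h5, h6⟩ := h (ε / 3) (by positivity)
  filter_upwards [h5, (Metric.tendsto_nhds.1 h4) (ε / 3) (by positivity)] with N hN hN'
  have e1 := abs_cesaro_sub_le (a := fun n => φ (w n)) (b := fun n => Ψ (w n))
    (fun n => h1 (w n)) N
  have e2 : |∫ x, φ x ∂P - ∫ x, Ψ x ∂P| ≤ ∫ x, r x ∂P := by
    rw [← integral_sub hi h2]
    exact abs_integral_le_integral_abs.trans (integral_mono (hi.sub h2).abs h3 h1)
  rw [Real.dist_eq] at hN'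
  rw [abs_le] at *
  rw [abs_lt] at hN'
  constructor <;> linarith [e1.1, e1.2, e2.1, e2.2, hN'.1, hN'.2]

end Cesaro


/-! ### A strong law of large numbers and the maximal ergodic inequality -/

section LargeNumbers

variable {Ω : Type*}

/-- `maxSum T g N` is the maximum of `0` and the Birkhoff sums of `g` of lengths `1, …, N`. -/
noncomputable def maxSum {Ω : Type*} (T : Ω → Ω) (g : Ω → ℝ) : ℕ → Ω → ℝ
  | 0 => fun _ => 0
  | N + 1 => fun w => max 0 (g w + maxSum T g N (T w))

lemma maxSum_nonneg (T : Ω → Ω) (g : Ω → ℝ) (N : ℕ) (w : Ω) : 0 ≤ maxSum T g N w := by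
  cases N with
  | zero => exact le_rfl
  | succ N => exact le_max_left _ _

lemma maxSum_le_succ (T : Ω → Ω) (g : Ω → ℝ) (N : ℕ) (w : Ω) :
    maxSum T g N w ≤ maxSum T g (N + 1) w := by
  induction N generalizing w with
  | zero => exact maxSum_nonneg T g 1 w
  | succ N ih => exact max_le_max le_rfl (by linarith [ih (T w)])

lemma sum_le_maxSum (T : Ω → Ω) (g : Ω → ℝ) (N : ℕ) (w : Ω) :
    ∑ n ∈ Finset.range N, g (T^[n] w) ≤ maxSum T g N w := by
  induction N generalizing w with
  | zero => simp [maxSum]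
  | succ N ih =>
    rw [Finset.sum_range_succ']
    refine le_trans ?_ (le_max_right _ _)
    have := ih (T w)
    simp only [Function.iterate_succ, Function.comp, Function.iterate_zero, id] at this ⊢
    linarith

variable [MeasurableSpace Ω] {P : Measure Ω}

lemma integral_comp_measurePreserving {Ω' : Type*} [MeasurableSpace Ω'] {P' : Measure Ω'}
    {T : Ω → Ω'} (hT : MeasurePreserving T P P') {g : Ω' → ℝ} (hg : AEStronglyMeasurable g P') :
    ∫ w, g (T w) ∂P = ∫ w, g w ∂P' := by
  rw [← hT.map_eq, integral_map hT.aemeasurable (hT.map_eq.symm ▸ hg)]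

lemma integral_sq_sum_le_of_finite_range [IsProbabilityMeasure P] {ξ : ℕ → Ω → ℝ}
    (hm : ∀ n, Measurable (ξ n)) {M : ℝ}
    (hM : ∀ n w, |ξ n w| ≤ M) {p : ℕ} (h : ∀ m n, m + p ≤ n → ∫ w, ξ m w * ξ n w ∂P = 0)
    (N : ℕ) : ∫ w, (∑ n ∈ Finset.range N, ξ n w) ^ 2 ∂P ≤ N * (2 * p * M ^ 2) := by
  have hb : ∀ m n w, |ξ m w * ξ n w| ≤ M ^ 2 := fun m n w => by
    rw [abs_mul, sq]
    exact mul_le_mul (hM m w) (hM n w) (abs_nonneg _) ((abs_nonneg _).trans (hM m w))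
  have hi : ∀ m n, Integrable (fun w => ξ m w * ξ n w) P := fun m n =>
    Integrable.of_bound ((hm m).mul (hm n)).aestronglyMeasurable (M ^ 2)
      (ae_of_all _ fun w => hb m n w)
  have hc : ∀ m n, ∫ w, ξ m w * ξ n w ∂P ≤
      if n ∈ Finset.Ico (m - p) (m + p) then M ^ 2 else 0 := by
    intro m n
    split_ifs with hmn
    · refine (integral_mono (hi m n) (integrable_const (M ^ 2))
        fun w => (le_abs_self _).trans (hb m n w)).trans (by simp)
    · rw [Finset.mem_Ico, not_and_or, not_le, not_lt] at hmn
      rcases hmn with hmn | hmn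
      · simp_rw [mul_comm (ξ m _)]
        exact (h n m (by omega)).le
      · exact (h m n hmn).le
  have e : ∀ w, (∑ n ∈ Finset.range N, ξ n w) ^ 2
      = ∑ m ∈ Finset.range N, ∑ n ∈ Finset.range N, ξ m w * ξ n w := fun w => by
    rw [sq, Finset.sum_mul_sum]
  simp_rw [e]
  rw [integral_finsetSum _ fun m _ => integrable_finsetSum _ fun n _ => hi m n]
  have : ∀ m ∈ Finset.range N,
      ∫ w, ∑ n ∈ Finset.range N, ξ m w * ξ n w ∂P ≤ 2 * p * M ^ 2 := by
    intro m _
    rw [integral_finsetSum _ fun n _ => hi m n]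
    refine (Finset.sum_le_sum fun n _ => hc m n).trans ?_
    rw [← Finset.sum_filter, Finset.sum_const, nsmul_eq_mul]
    refine mul_le_mul_of_nonneg_right ?_ (sq_nonneg M)
    have h1 : ((Finset.range N).filter fun n => n ∈ Finset.Ico (m - p) (m + p)).card
        ≤ (Finset.Ico (m - p) (m + p)).card :=
      Finset.card_le_card fun n hn => (Finset.mem_filter.1 hn).2
    rw [Nat.card_Ico] at h1
    exact_mod_cast (by omega : _ ≤ 2 * p)
  refine (Finset.sum_le_sum this).trans ?_
  simp

/-- A strong law of large numbers for bounded variables whose correlations vanish at distance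
at least `p`: the averages tend to `0` along the squares because their variances are summable,
and boundedness takes care of the gaps. -/
theorem ae_tendsto_cesaro_zero [IsProbabilityMeasure P] {ξ : ℕ → Ω → ℝ}
    (hm : ∀ n, Measurable (ξ n)) {M : ℝ}
    (hM : ∀ n w, |ξ n w| ≤ M) {p : ℕ} (h : ∀ m n, m + p ≤ n → ∫ w, ξ m w * ξ n w ∂P = 0) :
    ∀ᵐ w ∂P, Tendsto (cesaro fun n => ξ n w) atTop (𝓝 0) := by
  have hM0 : 0 ≤ M := by
    obtain ⟨w⟩ : Nonempty Ω := nonempty_of_isProbabilityMeasure P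
    exact (abs_nonneg _).trans (hM 0 w)
  set Q : ℕ → Ω → ℝ := fun k w => (cesaro (fun n => ξ n w) ((k + 1) ^ 2)) ^ 2 with hQ
  have hQm : ∀ k, Measurable (Q k) := fun k => by
    simp only [hQ, cesaro]
    exact ((Finset.measurable_fun_sum _ fun n _ => hm n).const_mul _).pow_const 2
  have hab : ∀ N w, |∑ n ∈ Finset.range N, ξ n w| ≤ N * M := fun N w =>
    (Finset.abs_sum_le_sum_abs _ _).trans ((Finset.sum_le_sum fun n _ => hM n w).trans (by simp))
  have hQi : ∀ k, Integrable (Q k) P := fun k => by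
    refine Integrable.of_bound (hQm k).aestronglyMeasurable (M ^ 2) (ae_of_all _ fun w => ?_)
    rw [Real.norm_eq_abs, abs_of_nonneg (sq_nonneg _), hQ]
    refine sq_le_sq' ?_ ?_
    all_goals
      have hpos : (0 : ℝ) < (((k + 1) ^ 2 : ℕ) : ℝ) := by positivity
      have h1 := abs_le.1 (hab ((k + 1) ^ 2) w)
      simp only [cesaro]
    · rw [← div_eq_inv_mul, le_div_iff₀ hpos]; linarith [h1.1]
    · rw [← div_eq_inv_mul, div_le_iff₀ hpos]; linarith [h1.2]
  have hQb : ∀ k, ∫ w, Q k w ∂P ≤ 2 * p * M ^ 2 * (1 / ((k : ℝ) + 1) ^ 2) := by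
    intro k
    have e : ∀ w, Q k w = ((((k + 1) ^ 2 : ℕ) : ℝ)⁻¹) ^ 2 *
        (∑ n ∈ Finset.range ((k + 1) ^ 2), ξ n w) ^ 2 := fun w => by
      simp only [hQ, cesaro, mul_pow]
    simp_rw [e]
    rw [integral_const_mul]
    refine (mul_le_mul_of_nonneg_left (integral_sq_sum_le_of_finite_range hm hM h _)
      (sq_nonneg _)).trans (le_of_eq ?_)
    push_cast
    field_simp
  have hsum : ∀ᵐ w ∂P, Summable fun k => Q k w := by
    have h1 : ∑' k, ∫⁻ w, ENNReal.ofReal (Q k w) ∂P ≠ ⊤ := by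
      have hs : Summable fun k : ℕ => 2 * p * M ^ 2 * (1 / ((k : ℝ) + 1) ^ 2) := by
        refine Summable.mul_left _ ?_
        have := (summable_nat_add_iff 1).2 (Real.summable_one_div_nat_pow.2 (one_lt_two))
        simpa using this
      refine ne_top_of_le_ne_top hs.tsum_ofReal_ne_top (ENNReal.tsum_le_tsum fun k => ?_)
      rw [← ofReal_integral_eq_lintegral_ofReal (hQi k) (ae_of_all _ fun w => sq_nonneg _)]
      exact ENNReal.ofReal_le_ofReal (hQb k)
    rw [← lintegral_tsum fun k => (hQm k).ennreal_ofReal.aemeasurable] at h1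
    filter_upwards [ae_lt_top (Measurable.tsum fun k => (hQm k).ennreal_ofReal) h1] with w hw
    have := ENNReal.summable_toReal hw.ne
    refine this.congr fun k => ?_
    exact ENNReal.toReal_ofReal (sq_nonneg _)
  filter_upwards [hsum] with w hw
  have hsq : Tendsto (fun k : ℕ => |cesaro (fun n => ξ n w) ((k + 1) ^ 2)|) atTop (𝓝 0) := by
    have := (Real.continuous_sqrt.tendsto 0).comp hw.tendsto_atTop_zero
    simpa [hQ, Function.comp_def, Real.sqrt_sq_eq_abs] using this
  have hsq' : Tendsto (fun k : ℕ => |cesaro (fun n => ξ n w) (k ^ 2)|) atTop (𝓝 0) :=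
    (tendsto_add_atTop_iff_nat 1).1 hsq
  have hsqrt : Tendsto Nat.sqrt atTop atTop :=
    tendsto_atTop_atTop.2 fun b => ⟨b ^ 2, fun a ha => Nat.le_sqrt'.2 ha⟩
  have hlim : Tendsto (fun N : ℕ => |cesaro (fun n => ξ n w) (N.sqrt ^ 2)| + 2 * M / (N.sqrt : ℝ))
      atTop (𝓝 0) := by
    have h2 := (tendsto_const_div_atTop_nhds_zero_nat (2 * M)).comp hsqrt
    simpa [Function.comp_def] using (hsq'.comp hsqrt).add h2
  refine squeeze_zero_norm' ?_ hlim
  filter_upwards [eventually_ge_atTop 1] with N hN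
  have hk1 : 1 ≤ N.sqrt := Nat.le_sqrt'.2 (by simpa using hN)
  have hkN : N.sqrt ^ 2 ≤ N := Nat.sqrt_le' N
  have hNk : N ≤ N.sqrt ^ 2 + 2 * N.sqrt := by nlinarith [Nat.sqrt_le_add N]
  generalize N.sqrt = k at hk1 hkN hNk ⊢
  have hk0 : (0 : ℝ) < k := by exact_mod_cast hk1
  have hN0 : (0 : ℝ) < N := by exact_mod_cast hN
  obtain ⟨d, rfl⟩ := Nat.exists_eq_add_of_le hkN
  have hd : (d : ℝ) ≤ 2 * k := by exact_mod_cast (by omega : d ≤ 2 * k)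
  have hrest : |∑ n ∈ Finset.range d, ξ (k ^ 2 + n) w| ≤ d * M :=
    (Finset.abs_sum_le_sum_abs _ _).trans ((Finset.sum_le_sum fun n _ => hM _ w).trans (by simp))
  have hkk : ((k : ℝ) ^ 2) ≤ ((k ^ 2 + d : ℕ) : ℝ) := by
    push_cast
    linarith [Nat.cast_nonneg (α := ℝ) d]
  have hk2 : (0 : ℝ) < (k : ℝ) ^ 2 := by positivity
  rw [Real.norm_eq_abs, cesaro, Finset.sum_range_add, abs_mul, abs_of_nonneg (by positivity),
    cesaro, abs_mul, abs_of_nonneg (a := (((k ^ 2 : ℕ) : ℝ))⁻¹) (by positivity)]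
  have e2 : 2 * M / (k : ℝ) = ((k : ℝ) ^ 2)⁻¹ * (2 * k * M) := by field_simp
  rw [e2]
  push_cast at hkk ⊢
  rw [← mul_add]
  refine mul_le_mul (inv_anti₀ hk2 hkk) ?_ (abs_nonneg _) (by positivity)
  refine (abs_add_le _ _).trans (add_le_add le_rfl (hrest.trans ?_))
  exact mul_le_mul_of_nonneg_right hd hM0

lemma measurable_maxSum {T : Ω → Ω} (hT : Measurable T) {g : Ω → ℝ} (hg : Measurable g) (N : ℕ) :
    Measurable (maxSum T g N) := by
  induction N with
  | zero => exact measurable_const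
  | succ N ih => exact measurable_const.max (hg.add (ih.comp hT))

lemma integrable_maxSum {T : Ω → Ω} (hT : MeasurePreserving T P P) {g : Ω → ℝ}
    (hg : Integrable g P) (N : ℕ) : Integrable (maxSum T g N) P := by
  induction N with
  | zero => exact integrable_zero _ _ _
  | succ N ih =>
    exact (integrable_zero _ _ _).sup (hg.add (hT.integrable_comp_of_integrable ih))

/-- The maximal ergodic inequality, by Garsia's argument. -/
theorem integral_setOf_maxSum_pos_nonneg {T : Ω → Ω} (hT : MeasurePreserving T P P) {g : Ω → ℝ}
    (hgm : Measurable g) (hg : Integrable g P) (N : ℕ) :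
    0 ≤ ∫ w in {w | 0 < maxSum T g N w}, g w ∂P := by
  cases N with
  | zero => simp [maxSum]
  | succ N =>
  set F := maxSum T g (N + 1) with hF
  have hFm : Measurable F := measurable_maxSum hT.measurable hgm _
  have hFi : Integrable F P := integrable_maxSum hT hg _
  have hD : MeasurableSet {w | 0 < F w} := measurableSet_lt measurable_const hFm
  have hTi : Integrable (fun w => F (T w)) P := hT.integrable_comp_of_integrable hFi
  have e0 : ∫ w, F (T w) ∂P = ∫ w, F w ∂P :=
    integral_comp_measurePreserving hT hFm.aestronglyMeasurable
  have e1 : ∫ w in {w | 0 < F w}, F w ∂P = ∫ w, F w ∂P :=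
    setIntegral_eq_integral_of_forall_compl_eq_zero fun w hw =>
      le_antisymm (not_lt.1 hw) (maxSum_nonneg _ _ _ _)
  have e2 : ∫ w in {w | 0 < F w}, F (T w) ∂P ≤ ∫ w, F (T w) ∂P :=
    setIntegral_le_integral hTi (ae_of_all _ fun w => maxSum_nonneg _ _ _ _)
  have e3 : ∫ w in {w | 0 < F w}, (F w - F (T w)) ∂P ≤ ∫ w in {w | 0 < F w}, g w ∂P := by
    refine setIntegral_mono_on (hFi.sub hTi).integrableOn hg.integrableOn hD fun w hw => ?_
    have h1 : F w = max 0 (g w + maxSum T g N (T w)) := rfl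
    have h2 := maxSum_le_succ T g N (T w)
    rw [← hF] at h2
    have h3 : F w = g w + maxSum T g N (T w) := by
      rcases max_choice 0 (g w + maxSum T g N (T w)) with h | h
      · rw [h] at h1; exact absurd h1 (ne_of_gt hw)
      · rw [h1, h]
    linarith
  rw [integral_sub hFi.integrableOn hTi.integrableOn] at e3
  linarith

/-- Weak-type bound for the maximal frequency of visits to a set. -/
theorem measure_exists_lt_cesaro_indicator_le [IsProbabilityMeasure P] {T : Ω → Ω}
    (hT : MeasurePreserving T P P)
    {A : Set Ω} (hA : MeasurableSet A) {c : ℝ} (hc : 0 < c) :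
    P {w | ∃ N, c < cesaro (fun n => A.indicator 1 (T^[n] w)) N} ≤ P A / ENNReal.ofReal c := by
  set g : Ω → ℝ := fun w => A.indicator 1 w - c with hg
  have hgm : Measurable g := (measurable_one.indicator hA).sub_const c
  have hgi : Integrable g P := ((integrable_const (1 : ℝ)).indicator hA).sub (integrable_const c)
  have hsub : {w | ∃ N, c < cesaro (fun n => A.indicator 1 (T^[n] w)) N}
      ⊆ ⋃ N, {w | 0 < maxSum T g N w} := by
    rintro w ⟨N, hN⟩
    refine Set.mem_iUnion.2 ⟨N, lt_of_lt_of_le ?_ (sum_le_maxSum T g N w)⟩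
    have hN0 : N ≠ 0 := by
      rintro rfl; simp only [cesaro, Finset.range_zero, Finset.sum_empty, mul_zero] at hN; linarith
    have hN1 : (0 : ℝ) < N := by exact_mod_cast Nat.pos_of_ne_zero hN0
    rw [cesaro, ← div_eq_inv_mul, lt_div_iff₀ hN1] at hN
    simp only [hg, Finset.sum_sub_distrib, Finset.sum_const, Finset.card_range, nsmul_eq_mul]
    linarith
  refine (measure_mono hsub).trans ?_
  have hmono : Monotone fun N => {w | 0 < maxSum T g N w} :=
    monotone_nat_of_le_succ fun N w hw => lt_of_lt_of_le hw (maxSum_le_succ T g N w)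
  rw [hmono.measure_iUnion]
  refine iSup_le fun N => ?_
  set D := {w | 0 < maxSum T g N w} with hDdef
  have hD : MeasurableSet D :=
    measurableSet_lt measurable_const (measurable_maxSum hT.measurable hgm N)
  have h0 := integral_setOf_maxSum_pos_nonneg hT hgm hgi N
  have h00 : ∫ w in D, g w ∂P = ∫ w in D, A.indicator (1 : Ω → ℝ) w ∂P - ∫ _ in D, c ∂P :=
    integral_sub ((integrable_const (1 : ℝ)).indicator hA).integrableOn
      (integrable_const c).integrableOn
  rw [← hDdef, h00] at h0
  have e : ∫ w in D, A.indicator (1 : Ω → ℝ) w ∂P = P.real (A ∩ D) := by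
    rw [integral_indicator_one hA, measureReal_restrict_apply hA]
  rw [e, setIntegral_const, smul_eq_mul] at h0
  have h1 : P.real (A ∩ D) ≤ P.real A := measureReal_mono Set.inter_subset_left
  rw [ENNReal.le_div_iff_mul_le (Or.inl (by simpa using hc)) (Or.inl ENNReal.ofReal_ne_top),
    ← ofReal_measureReal (μ := P) (s := D), ← ofReal_measureReal (μ := P) (s := A),
    ← ENNReal.ofReal_mul measureReal_nonneg]
  exact ENNReal.ofReal_le_ofReal (by linarith)

/-- If the measures of the sets `A j` decay fast, almost every orbit visits them, for large `j`,
with a frequency that is small for all times simultaneously. -/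
theorem ae_eventually_forall_cesaro_indicator_le [IsProbabilityMeasure P] {T : Ω → Ω}
    (hT : MeasurePreserving T P P)
    {A : ℕ → Set Ω} (hA : ∀ j, MeasurableSet (A j))
    (hAs : ∀ j, P (A j) ≤ ENNReal.ofReal ((1 / 4) ^ j)) :
    ∀ᵐ w ∂P, ∀ᶠ j in atTop, ∀ N, cesaro (fun n => (A j).indicator 1 (T^[n] w)) N ≤ (1 / 2) ^ j := by
  have h1 : ∀ j : ℕ, P {w | ∃ N, (1 / 2 : ℝ) ^ j <
      cesaro (fun n => (A j).indicator 1 (T^[n] w)) N} ≤ ENNReal.ofReal ((1 / 2) ^ j) := by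
    intro j
    refine (measure_exists_lt_cesaro_indicator_le hT (hA j) (by positivity)).trans ?_
    refine (ENNReal.div_le_div_right (hAs j) _).trans ?_
    rw [← ENNReal.ofReal_div_of_pos (by positivity)]
    refine ENNReal.ofReal_le_ofReal (le_of_eq ?_)
    rw [← div_pow]; norm_num
  have h2 : ∑' j, P {w | ∃ N, (1 / 2 : ℝ) ^ j <
      cesaro (fun n => (A j).indicator 1 (T^[n] w)) N} ≠ ⊤ :=
    ne_top_of_le_ne_top
      (summable_geometric_of_lt_one (by norm_num : (0 : ℝ) ≤ 1 / 2)
        (by norm_num)).tsum_ofReal_ne_top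
      (ENNReal.tsum_le_tsum h1)
  filter_upwards [ae_eventually_notMem h2] with w hw
  filter_upwards [hw] with j hj N
  by_contra hcon
  exact hj ⟨N, not_le.1 hcon⟩

end LargeNumbers


/-! ### Bernoulli measures and the skew product -/

section Bernoulli

variable {E Z : Type*} {act : E → Z → Z}

/-- `join n c b` starts with the first `n` letters of `c` and continues with `b`. -/
def join {E : Type*} (n : ℕ) (c b : ℕ → E) : ℕ → E := fun i => if i < n then c i else b (i - n)

lemma join_of_lt {n i : ℕ} (c b : ℕ → E) (h : i < n) : join n c b i = c i := if_pos h

lemma join_add (n : ℕ) (c b : ℕ → E) : (fun i => join n c b (i + n)) = b := by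
  ext i; simp [join]

/-- The trajectory `z, b₀ z, b₁ b₀ z, …` of `z` driven by the letters of `b`. -/
def orbit {E Z : Type*} (act : E → Z → Z) (b : ℕ → E) (z : Z) : ℕ → Z
  | 0 => z
  | n + 1 => act (b n) (orbit act b z n)

/-- The skew product `(b, z) ↦ (σ b, b₀ z)` over the one-sided shift `σ`. -/
def skew {E Z : Type*} (act : E → Z → Z) (w : (ℕ → E) × Z) : (ℕ → E) × Z :=
  (fun i => w.1 (i + 1), act (w.1 0) w.2)

lemma orbit_congr {b c : ℕ → E} {n : ℕ} (h : ∀ i < n, b i = c i) (z : Z) :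
    orbit act b z n = orbit act c z n := by
  induction n with
  | zero => rfl
  | succ n ih =>
    simp only [orbit]
    rw [ih fun i hi => h i (by omega), h n (by omega)]

lemma skew_iterate (n : ℕ) (w : (ℕ → E) × Z) :
    (skew act)^[n] w = (fun i => w.1 (i + n), orbit act w.1 w.2 n) := by
  induction n with
  | zero => rfl
  | succ n ih =>
    rw [Function.iterate_succ_apply', ih]
    simp only [skew, orbit, zero_add, Prod.mk.injEq, and_true]
    ext i
    rw [add_assoc, add_comm 1 n]

lemma orbit_orbit (b : ℕ → E) (z : Z) (m n : ℕ) :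
    orbit act (fun i => b (i + m)) (orbit act b z m) n = orbit act b z (m + n) := by
  induction n with
  | zero => rfl
  | succ n ih => rw [← add_assoc, orbit, orbit, ih, add_comm n m]

variable [MeasurableSpace Z] {m : Measure Z}

lemma measurePreserving_orbit (hmp : ∀ e, MeasurePreserving (act e) m m) (b : ℕ → E) (n : ℕ) :
    MeasurePreserving (fun z => orbit act b z n) m m := by
  induction n with
  | zero => exact MeasurePreserving.id m
  | succ n ih => exact (hmp (b n)).comp ih

variable [MeasurableSpace E] (ν : Measure E) [IsProbabilityMeasure ν]

/-- Reading a Bernoulli sequence along an injection gives a Bernoulli sequence. -/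
lemma measurePreserving_comp_injective {ι ι' : Type*} {σ : ι' → ι} (hσ : σ.Injective) :
    MeasurePreserving (fun (b : ι → E) i => b (σ i))
      (Measure.infinitePi fun _ => ν) (Measure.infinitePi fun _ => ν) := by
  classical
  have hm : Measurable fun (b : ι → E) i => b (σ i) :=
    measurable_pi_lambda _ fun i => measurable_pi_apply _
  refine ⟨hm, Measure.eq_infinitePi _ fun s t ht => ?_⟩
  rw [Measure.map_apply hm (MeasurableSet.pi s.countable_toSet fun i _ => ht i)]
  have e : (fun (b : ι → E) i => b (σ i)) ⁻¹' Set.pi s t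
      = Set.pi (s.image σ) (fun i => if h : ∃ j, σ j = i then t h.choose else Set.univ) := by
    ext b
    simp only [Set.mem_preimage, Set.mem_pi, Finset.coe_image, Set.forall_mem_image]
    refine forall₂_congr fun j _ => ?_
    have h : ∃ j', σ j' = σ j := ⟨j, rfl⟩
    rw [dif_pos h, hσ h.choose_spec]
  rw [e, Measure.infinitePi_pi, Finset.prod_image fun i _ j _ h => hσ h]
  · refine Finset.prod_congr rfl fun j _ => ?_
    have h : ∃ j', σ j' = σ j := ⟨j, rfl⟩
    rw [dif_pos h, hσ h.choose_spec]
  · intro i _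
    split_ifs
    exacts [ht _, .univ]

lemma measurable_join (n : ℕ) : Measurable fun p : (ℕ → E) × (ℕ → E) => join n p.1 p.2 := by
  refine measurable_pi_lambda _ fun i => ?_
  simp only [join]
  split_ifs
  exacts [(measurable_pi_apply _).comp measurable_fst, (measurable_pi_apply _).comp measurable_snd]

/-- Independence of the first `n` letters and the later ones. -/
lemma measurePreserving_join (n : ℕ) :
    MeasurePreserving (fun p : (ℕ → E) × (ℕ → E) => join n p.1 p.2)
      ((Measure.infinitePi fun _ => ν).prod (Measure.infinitePi fun _ => ν))
      (Measure.infinitePi fun _ => ν) := by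
  refine ⟨measurable_join n, Measure.eq_infinitePi _ fun s t ht => ?_⟩
  rw [Measure.map_apply (measurable_join n) (MeasurableSet.pi s.countable_toSet fun i _ => ht i)]
  have e : (fun p : (ℕ → E) × (ℕ → E) => join n p.1 p.2) ⁻¹' Set.pi s t
      = Set.pi (s.filter (· < n)) t ×ˢ
        Set.pi ((s.filter (¬ · < n)).image (· - n)) (fun i => t (i + n)) := by
    ext ⟨c, b⟩
    simp only [Set.mem_preimage, Set.mem_pi, Set.mem_prod, Finset.coe_image, Set.forall_mem_image,
      Finset.coe_filter, Set.mem_ofPred_eq, Finset.mem_coe, join]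
    constructor
    · intro h
      refine ⟨fun i hi => ?_, fun i hi => ?_⟩
      · have := h i hi.1
        rwa [if_pos hi.2] at this
      · have := h i hi.1
        rwa [if_neg hi.2, show t i = t (i - n + n) by rw [Nat.sub_add_cancel (not_lt.1 hi.2)]]
          at this
    · intro h i hi
      by_cases hin : i < n
      · rw [if_pos hin]; exact h.1 i ⟨hi, hin⟩
      · rw [if_neg hin]
        have := h.2 (⟨hi, hin⟩ : i ∈ s ∧ ¬ i < n)
        rwa [Nat.sub_add_cancel (not_lt.1 hin)] at this
  rw [e, Measure.prod_prod, Measure.infinitePi_pi _ (fun i _ => ht i),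
    Measure.infinitePi_pi _ (fun i _ => ht (i + n)), Finset.prod_image,
    ← Finset.prod_filter_mul_prod_filter_not s (· < n)]
  · congr 1
    refine Finset.prod_congr rfl fun i hi => ?_
    rw [Nat.sub_add_cancel (not_lt.1 (Finset.mem_filter.1 hi).2)]
  · intro i hi j hj h
    have h1 := (Finset.mem_filter.1 (Finset.mem_coe.1 hi)).2
    have h2 := (Finset.mem_filter.1 (Finset.mem_coe.1 hj)).2
    simp only at h
    omega

variable [IsProbabilityMeasure m]

lemma measurable_orbit (hact : Measurable fun p : E × Z => act p.1 p.2) (n : ℕ) :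
    Measurable fun w : (ℕ → E) × Z => orbit act w.1 w.2 n := by
  induction n with
  | zero => exact measurable_snd
  | succ n ih =>
    exact hact.comp (((measurable_pi_apply n).comp measurable_fst).prodMk ih)

lemma measurable_skew (hact : Measurable fun p : E × Z => act p.1 p.2) :
    Measurable (skew act) := by
  have h0 : Measurable fun w : (ℕ → E) × Z => (w.1 0, w.2) :=
    ((measurable_pi_apply 0).comp measurable_fst).prodMk measurable_snd
  exact Measurable.prodMk (measurable_pi_lambda _ fun i => (measurable_pi_apply _).comp
    measurable_fst) (hact.comp h0)

/-- The measure of an event about the first `n` letters and the position after `n` steps: the later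
letters can be replaced by an independent sequence. -/
lemma measure_inter_preimage_skew_iterate (hact : Measurable fun p : E × Z => act p.1 p.2)
    {n : ℕ} {A D : Set ((ℕ → E) × Z)} (hA : MeasurableSet A) (hD : MeasurableSet D)
    (hDn : ∀ b c z, (∀ i < n, b i = c i) → ((b, z) ∈ D ↔ (c, z) ∈ D)) :
    ((Measure.infinitePi fun _ => ν).prod m) (D ∩ (skew act)^[n] ⁻¹' A) =
      ∫⁻ w in D, (Measure.infinitePi fun _ => ν) {b | (b, orbit act w.1 w.2 n) ∈ A}
        ∂((Measure.infinitePi fun _ => ν).prod m) := by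
  set β : Measure (ℕ → E) := Measure.infinitePi fun _ => ν with hβ
  have hsk := (measurable_skew hact).iterate n
  have hor := measurable_orbit hact n
  have hset : MeasurableSet (D ∩ (skew act)^[n] ⁻¹' A) := hD.inter (hsk hA)
  have hfib : Measurable fun z => β {b | (b, z) ∈ A} := measurable_measure_prodMk_right hA
  have hDA : Measurable (D.indicator fun w => β {b | (b, orbit act w.1 w.2 n) ∈ A}) :=
    Measurable.indicator (hfib.comp hor) hD
  rw [← lintegral_indicator_one hset, ← lintegral_indicator hD,
    lintegral_prod_symm' _ (measurable_one.indicator hset), lintegral_prod_symm' _ hDA]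
  refine lintegral_congr fun z => ?_
  have hz : Measurable fun b : ℕ → E =>
      (D ∩ (skew act)^[n] ⁻¹' A).indicator (1 : (ℕ → E) × Z → ENNReal) (b, z) :=
    (measurable_one.indicator hset).comp (measurable_id.prodMk measurable_const)
  refine ((measurePreserving_join ν n).lintegral_comp hz).symm.trans ?_
  refine (lintegral_prod _ (hz.comp (measurable_join n)).aemeasurable).trans ?_
  refine lintegral_congr fun c => ?_
  have hAz : MeasurableSet {b | (b, orbit act c z n) ∈ A} :=
    (measurable_id.prodMk measurable_const) hA
  have hmem : ∀ b, (join n c b, z) ∈ D ↔ (c, z) ∈ D := fun b =>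
    hDn _ _ z fun i hi => join_of_lt c b hi
  have hit : ∀ b, (skew act)^[n] (join n c b, z) = (b, orbit act c z n) := fun b => by
    rw [skew_iterate, join_add, orbit_congr (fun i hi => join_of_lt c b hi)]
  by_cases hc : (c, z) ∈ D
  · rw [Set.indicator_of_mem hc, ← lintegral_indicator_one hAz]
    refine lintegral_congr fun b => ?_
    have : (join n c b, z) ∈ D ∩ (skew act)^[n] ⁻¹' A ↔ b ∈ {b | (b, orbit act c z n) ∈ A} := by
      rw [Set.mem_inter_iff, hmem, Set.mem_preimage, hit]
      exact and_iff_right hc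
    exact Set.indicator_eq_indicator this rfl
  · rw [Set.indicator_of_notMem hc]
    simp [hmem, hc]

lemma lintegral_orbit (hact : Measurable fun p : E × Z => act p.1 p.2)
    (hmp : ∀ e, MeasurePreserving (act e) m m) (n : ℕ) {F : Z → ENNReal} (hF : Measurable F) :
    ∫⁻ w, F (orbit act w.1 w.2 n) ∂((Measure.infinitePi fun _ => ν).prod m) = ∫⁻ z, F z ∂m := by
  have h : Measurable fun w : (ℕ → E) × Z => F (orbit act w.1 w.2 n) :=
    hF.comp (measurable_orbit hact n)
  rw [lintegral_prod _ h.aemeasurable]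
  simp_rw [(measurePreserving_orbit hmp _ n).lintegral_comp hF]
  simp

lemma measurePreserving_skew (hact : Measurable fun p : E × Z => act p.1 p.2)
    (hmp : ∀ e, MeasurePreserving (act e) m m) :
    MeasurePreserving (skew act) ((Measure.infinitePi fun _ => ν).prod m)
      ((Measure.infinitePi fun _ => ν).prod m) := by
  refine ⟨measurable_skew hact, Measure.ext fun A hA => ?_⟩
  rw [Measure.map_apply (measurable_skew hact) hA]
  have := measure_inter_preimage_skew_iterate ν (m := m) hact (n := 1) hA MeasurableSet.univ
    (fun _ _ _ _ => by simp)
  rw [Set.univ_inter, Function.iterate_one] at this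
  rw [this, Measure.restrict_univ, Measure.prod_apply_symm hA]
  exact lintegral_orbit ν hact hmp 1 (measurable_measure_prodMk_right hA)

/-- The skew product is ergodic as soon as every measurable set that is invariant under almost
every letter is trivial. For an invariant set `A`, the measure of the fibre `A_z` is a harmonic
function of `z`, hence invariant under almost every letter, hence constant; this makes `A`
independent of all events depending on finitely many letters, and so of itself. -/
theorem ergodic_skew (hact : Measurable fun p : E × Z => act p.1 p.2)
    (hmp : ∀ e, MeasurePreserving (act e) m m)
    (herg : ∀ s : Set Z, MeasurableSet s → (∀ᵐ e ∂ν, act e ⁻¹' s =ᵐ[m] s) →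
      EventuallyConst s (ae m)) :
    Ergodic (skew act) ((Measure.infinitePi fun _ => ν).prod m) := by
  refine ⟨measurePreserving_skew ν hact hmp, ⟨fun A hA hinv => ?_⟩⟩
  set β : Measure (ℕ → E) := Measure.infinitePi fun _ => ν with hβ
  set F : Z → ENNReal := fun z => β {b | (b, z) ∈ A} with hF
  have hFm : Measurable F := measurable_measure_prodMk_right hA
  have hF1 : ∀ z, F z ≤ 1 := fun z => prob_le_one
  have hharm : ∀ z, F z = ∫⁻ e, F (act e z) ∂ν := by
    intro z
    have hF1m : Measurable fun w : (ℕ → E) × Z => F (orbit act w.1 w.2 1) :=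
      hFm.comp (measurable_orbit hact 1)
    have h1 := measure_inter_preimage_skew_iterate ν (m := Measure.dirac z) hact (n := 1) hA
      MeasurableSet.univ (fun _ _ _ _ => by simp)
    rw [Set.univ_inter, Function.iterate_one, hinv, Measure.restrict_univ,
      Measure.prod_apply_symm hA, lintegral_dirac' _ (measurable_measure_prodMk_right hA)] at h1
    refine h1.trans ((lintegral_prod_symm' _ hF1m).trans ?_)
    rw [lintegral_dirac' _ hF1m.lintegral_prod_left']
    exact (measurePreserving_eval_infinitePi (fun _ : ℕ => ν) 0).lintegral_comp
      (f := fun e => F (act e z)) (hFm.comp (hact.comp (measurable_id.prodMk measurable_const)))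
  set G : Z → ℝ := fun z => (F z).toReal with hG
  have hGm : Measurable G := hFm.ennreal_toReal
  have hG0 : ∀ z, 0 ≤ G z := fun z => ENNReal.toReal_nonneg
  have hG1 : ∀ z, G z ≤ 1 := fun z => by
    simpa using ENNReal.toReal_mono ENNReal.one_ne_top (hF1 z)
  have hGact : Measurable fun p : E × Z => G (act p.1 p.2) := hGm.comp hact
  have hGharm : ∀ z, G z = ∫ e, G (act e z) ∂ν := by
    intro z
    rw [hG]
    simp only
    rw [hharm z, integral_toReal]
    · exact (hFm.comp (hact.comp (measurable_id.prodMk measurable_const))).aemeasurable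
    · exact ae_of_all _ fun e => (hF1 _).trans_lt ENNReal.one_lt_top
  have hbd : ∀ {α : Type _} [MeasurableSpace α] {ρ : Measure α} [IsProbabilityMeasure ρ]
      {f : α → ℝ}, Measurable f → (∀ x, |f x| ≤ 1) → Integrable f ρ := fun hf h =>
    Integrable.of_bound hf.aestronglyMeasurable 1 (ae_of_all _ h)
  have hGabs : ∀ z, |G z| ≤ 1 := fun z => by rw [abs_of_nonneg (hG0 z)]; exact hG1 z
  have hmul : ∀ {a b : ℝ}, |a| ≤ 1 → |b| ≤ 1 → |a * b| ≤ 1 := fun {a b} ha hb => by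
    rw [abs_mul]; exact mul_le_one₀ ha (abs_nonneg _) hb
  -- Since `G` is harmonic and the letters preserve `m`, the mixed term below equals `∫ G²`.
  have hvar : ∫ p, (G (act p.1 p.2) - G p.2) ^ 2 ∂(ν.prod m) = 0 := by
    have i1 : Integrable (fun p : E × Z => G (act p.1 p.2) * G (act p.1 p.2)) (ν.prod m) :=
      hbd (hGact.mul hGact) fun p => hmul (hGabs _) (hGabs _)
    have i2 : Integrable (fun p : E × Z => G (act p.1 p.2) * G p.2) (ν.prod m) :=
      hbd (hGact.mul (hGm.comp measurable_snd)) fun p => hmul (hGabs _) (hGabs _)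
    have i3 : Integrable (fun p : E × Z => G p.2 * G p.2) (ν.prod m) :=
      hbd ((hGm.comp measurable_snd).mul (hGm.comp measurable_snd))
        fun p => hmul (hGabs _) (hGabs _)
    have e1 : ∫ p : E × Z, G (act p.1 p.2) * G (act p.1 p.2) ∂(ν.prod m) = ∫ z, G z * G z ∂m := by
      rw [integral_prod _ i1]
      have : ∀ e, ∫ z, G (act e z) * G (act e z) ∂m = ∫ z, G z * G z ∂m := fun e =>
        integral_comp_measurePreserving (hmp e) (g := fun z => G z * G z)
          (hGm.mul hGm).aestronglyMeasurable
      simp [this]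
    have e2 : ∫ p : E × Z, G (act p.1 p.2) * G p.2 ∂(ν.prod m) = ∫ z, G z * G z ∂m := by
      rw [integral_prod_symm _ i2]
      refine integral_congr_ae (ae_of_all _ fun z => ?_)
      simp only
      rw [integral_mul_const, ← hGharm]
    have e3 : ∫ p : E × Z, G p.2 * G p.2 ∂(ν.prod m) = ∫ z, G z * G z ∂m := by
      rw [integral_prod _ i3]; simp
    have : ∀ p : E × Z, (G (act p.1 p.2) - G p.2) ^ 2 =
        G (act p.1 p.2) * G (act p.1 p.2) - 2 * (G (act p.1 p.2) * G p.2) + G p.2 * G p.2 :=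
      fun p => by ring
    simp_rw [this]
    have i12 := i1.sub (i2.const_mul 2)
    have := integral_add i12 i3
    simp only [Pi.sub_apply] at this
    rw [this, integral_sub i1 (i2.const_mul 2), integral_const_mul, e1, e2, e3]
    ring
  have hae : ∀ᵐ e ∂ν, ∀ᵐ z ∂m, G (act e z) = G z := by
    have hi : Integrable (fun p : E × Z => (G (act p.1 p.2) - G p.2) ^ 2) (ν.prod m) :=
      hbd ((hGact.sub (hGm.comp measurable_snd)).pow_const 2) fun p => by
        rw [abs_of_nonneg (sq_nonneg _)]
        have := hG0 (act p.1 p.2); have := hG1 (act p.1 p.2); have := hG0 p.2; have := hG1 p.2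
        nlinarith
    have h0 := (integral_eq_zero_iff_of_nonneg (fun p => sq_nonneg _) hi).1 hvar
    have := Measure.ae_ae_of_ae_prod h0
    filter_upwards [this] with e he
    filter_upwards [he] with z hz
    simpa [sub_eq_zero] using hz
  obtain ⟨c, hc⟩ : ∃ c, G =ᵐ[m] Function.const Z c := by
    refine exists_eventuallyEq_const_of_forall_separating MeasurableSet fun U hU => ?_
    have h1 := herg (G ⁻¹' U) (hGm hU) (by
      filter_upwards [hae] with e he
      filter_upwards [he] with z hz
      exact propext (by
        change G (act e z) ∈ U ↔ G z ∈ U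
        rw [hz]))
    rw [eventuallyConst_set] at h1
    exact h1
  have hFc : F =ᵐ[m] fun _ => ENNReal.ofReal c := by
    filter_upwards [hc] with z hz
    rw [← ENNReal.ofReal_toReal ((hF1 z).trans_lt ENNReal.one_lt_top).ne]
    exact congrArg _ hz
  have hinvn : ∀ n, (skew act)^[n] ⁻¹' A = A := fun n => by
    induction n with
    | zero => rfl
    | succ n ih => rw [Function.iterate_succ, Set.preimage_comp, ih, hinv]
  have hcyl : ∀ (n : ℕ) (D : Set ((ℕ → E) × Z)), MeasurableSet D →
      (∀ b c z, (∀ i < n, b i = c i) → ((b, z) ∈ D ↔ (c, z) ∈ D)) →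
      (β.prod m) (D ∩ A) = ENNReal.ofReal c * (β.prod m) D := by
    intro n D hD hDn
    have h1 := measure_inter_preimage_skew_iterate ν (m := m) hact hA hD hDn
    rw [hinvn n] at h1
    rw [h1]
    have h2 : ∀ᵐ w ∂(β.prod m), F (orbit act w.1 w.2 n) = ENNReal.ofReal c := by
      have hms : MeasurableSet {w : (ℕ → E) × Z | F (orbit act w.1 w.2 n) = ENNReal.ofReal c} :=
        measurableSet_eq_fun (hFm.comp (measurable_orbit hact n)) measurable_const
      refine (Measure.ae_prod_mem_iff_ae_ae_mem hms).2 (ae_of_all _ fun b => ?_)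
      exact (measurePreserving_orbit hmp b n).quasiMeasurePreserving.ae hFc
    rw [lintegral_congr_ae (ae_restrict_of_ae h2)]
    simp
  have hext : (β.prod m).restrict A = ENNReal.ofReal c • (β.prod m) := by
    refine ext_of_generate_finite
      (Set.image2 (· ×ˢ ·) (measurableCylinders fun _ : ℕ => E) {s : Set Z | MeasurableSet s})
      ?_ (isPiSystem_measurableCylinders.prod MeasurableSpace.isPiSystem_measurableSet) ?_ ?_
    · refine (generateFrom_eq_prod generateFrom_measurableCylinders
        MeasurableSpace.generateFrom_measurableSet ?_ isCountablySpanning_measurableSet).symm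
      exact ⟨fun _ => Set.univ, fun _ => univ_mem_measurableCylinders _, Set.iUnion_const _⟩
    · rintro _ ⟨C, hC, t, ht, rfl⟩
      have hCm := MeasurableSet.of_mem_measurableCylinders hC
      have hprod : MeasurableSet (C ×ˢ t) := hCm.prod ht
      obtain ⟨s, S, hS, rfl⟩ := (mem_measurableCylinders _).1 hC
      rw [Measure.restrict_apply hprod, Measure.smul_apply, smul_eq_mul]
      refine hcyl (s.sup id + 1) _ hprod fun b c z hbc => ?_
      have : s.restrict b = s.restrict c := by
        ext ⟨i, hi⟩
        exact hbc i (Nat.lt_succ_of_le (Finset.le_sup (f := id) hi))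
      simp only [Set.mem_prod, mem_cylinder, this]
    · have := hcyl 0 Set.univ MeasurableSet.univ (fun _ _ _ _ => by simp)
      simpa using this
  have h1 : (β.prod m) A = ENNReal.ofReal c := by
    have := congrArg (fun ρ : Measure _ => ρ Set.univ) hext
    simpa using this
  have h2 : (β.prod m) A = ENNReal.ofReal c * (β.prod m) A := by
    have := congrArg (fun ρ : Measure _ => ρ A) hext
    simpa using this
  rw [← h1] at h2
  have h3 : (β.prod m) A = 0 ∨ (β.prod m) A = 1 := by
    by_cases h0 : (β.prod m) A = 0
    · exact Or.inl h0
    · refine Or.inr ?_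
      have h4 : (β.prod m) A * 1 = (β.prod m) A * (β.prod m) A := by rw [mul_one]; exact h2
      exact ((ENNReal.mul_right_inj h0 (measure_ne_top _ _)).1 h4).symm
  rw [eventuallyConst_set']
  rcases h3 with h3 | h3
  · exact Or.inl (ae_eq_empty.2 h3)
  · refine Or.inr (ae_eq_univ.2 ((prob_compl_eq_zero_iff hA).2 h3))

end Bernoulli


/-! ### The mean ergodic theorem for bounded functions -/

section MeanErgodic

variable {Ω : Type*} [MeasurableSpace Ω] {P : Measure Ω} [IsProbabilityMeasure P]

/-- For an ergodic map, the Birkhoff averages of a bounded function converge in mean to its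
integral. -/
theorem tendsto_integral_abs_cesaro_sub {T : Ω → Ω} (hT : Ergodic T P) {H : Ω → ℝ}
    (hm : Measurable H) {M : ℝ} (hM : ∀ w, |H w| ≤ M) :
    Tendsto (fun L => ∫ w, |cesaro (fun l => H (T^[l] w)) L - ∫ v, H v ∂P| ∂P) atTop (𝓝 0) := by
  have hmp : MeasurePreserving T P P := hT.toMeasurePreserving
  have hL : MemLp H 2 P := MemLp.of_bound hm.aestronglyMeasurable M (ae_of_all _ hM)
  have hHn : ∀ n, MemLp (fun w => H (T^[n] w)) 2 P := fun n =>
    hL.comp_measurePreserving (hmp.iterate n)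
  have hD : ∀ L, MemLp (fun w => cesaro (fun l => H (T^[l] w)) L) 2 P := fun L =>
    (memLp_finsetSum (Finset.range L) fun l _ => hHn l).const_mul _
  set U : Lp ℝ 2 P →L[ℝ] Lp ℝ 2 P :=
    (Lp.compMeasurePreservingₗᵢ ℝ T hmp).toContinuousLinearMap with hU
  have hlim := U.tendsto_birkhoffAverage_orthogonalProjection
    (LinearIsometry.norm_toContinuousLinearMap_le _) (hL.toLp H)
  set y := (U.eqLocus (1 : Lp ℝ 2 P →L[ℝ] Lp ℝ 2 P)).orthogonalProjectionOnto (hL.toLp H)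
  have hUn : ∀ n, U^[n] (hL.toLp H) = (hHn n).toLp _ := fun n => by
    have h1 : (U : Lp ℝ 2 P → Lp ℝ 2 P) = Lp.compMeasurePreserving T hmp := rfl
    rw [h1, Lp.compMeasurePreserving_iterate]
    rfl
  have hB : ∀ L, birkhoffAverage ℝ U _root_.id L (hL.toLp H) = (hD L).toLp _ := fun L => by
    have h1 : birkhoffAverage ℝ U _root_.id L (hL.toLp H)
        = (L : ℝ)⁻¹ • ∑ l ∈ Finset.range L, (hHn l).toLp _ := by
      simp only [birkhoffAverage, birkhoffSum, id, hUn]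
    have hS : ∀ L, MemLp (fun w => ∑ l ∈ Finset.range L, H (T^[l] w)) 2 P := fun L =>
      memLp_finsetSum _ fun l _ => hHn l
    have h2 : ∑ l ∈ Finset.range L, (hHn l).toLp _ = (hS L).toLp _ := by
      induction L with
      | zero => exact (MemLp.toLp_zero (hS 0)).symm
      | succ L ih =>
        rw [Finset.sum_range_succ, ih (by simp only [birkhoffAverage, birkhoffSum, id, hUn]),
          ← MemLp.toLp_add]
        exact MemLp.toLp_congr _ _ (ae_of_all _ fun w => (Finset.sum_range_succ _ L).symm)
    rw [h1, h2, ← MemLp.toLp_const_smul]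
    rfl
  obtain ⟨c, hc⟩ : ∃ c, (y : Lp ℝ 2 P) =ᵐ[P] Function.const Ω c := by
    have hy : U (y : Lp ℝ 2 P) = y := y.2
    refine hT.ae_eq_const_of_ae_eq_comp_ae (Lp.aestronglyMeasurable _) ?_
    have h1 := Lp.coeFn_compMeasurePreserving (y : Lp ℝ 2 P) hmp
    have h2 : Lp.compMeasurePreserving T hmp (y : Lp ℝ 2 P) = y := hy
    rw [h2] at h1
    exact h1.symm
  have hmD : ∀ L, Measurable fun w => cesaro (fun l => H (T^[l] w)) L := fun L =>
    (Finset.measurable_fun_sum _ fun l _ => hm.comp (hmp.measurable.iterate l)).const_mul _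
  have hi : ∀ L, Integrable (fun w => cesaro (fun l => H (T^[l] w)) L) P := fun L =>
    (hD L).integrable one_le_two
  have h1 : Tendsto (fun L => ∫ w, |cesaro (fun l => H (T^[l] w)) L - c| ∂P) atTop (𝓝 0) := by
    have h2 := (tendsto_iff_norm_sub_tendsto_zero.1 hlim)
    refine squeeze_zero (fun L => integral_nonneg fun w => abs_nonneg _) (fun L => ?_) h2
    rw [hB, Lp.norm_def]
    have h3 : ((hD L).toLp _ - (y : Lp ℝ 2 P) : Lp ℝ 2 P) =ᵐ[P]
        fun w => cesaro (fun l => H (T^[l] w)) L - c := by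
      filter_upwards [Lp.coeFn_sub ((hD L).toLp _) (y : Lp ℝ 2 P), (hD L).coeFn_toLp, hc]
        with w h4 h5 h6
      rw [h4, Pi.sub_apply, h5, h6]; rfl
    rw [eLpNorm_congr_ae h3]
    have h4 : ∫ w, |cesaro (fun l => H (T^[l] w)) L - c| ∂P
        = (eLpNorm (fun w => cesaro (fun l => H (T^[l] w)) L - c) 1 P).toReal := by
      rw [eLpNorm_one_eq_lintegral_enorm]
      exact integral_norm_eq_lintegral_enorm ((hmD L).sub_const c).aestronglyMeasurable
    rw [h4]
    refine ENNReal.toReal_mono ?_ (eLpNorm_le_eLpNorm_of_exponent_le one_le_two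
      ((hmD L).sub_const c).aestronglyMeasurable)
    exact ((hD L).sub (memLp_const c)).eLpNorm_ne_top
  have hint : ∀ l, ∫ w, H (T^[l] w) ∂P = ∫ w, H w ∂P := fun l =>
    integral_comp_measurePreserving (hmp.iterate l) hm.aestronglyMeasurable
  have h5 : ∀ L, L ≠ 0 → ∫ w, cesaro (fun l => H (T^[l] w)) L ∂P = ∫ w, H w ∂P := fun L h0 => by
    have h0' : (L : ℝ) ≠ 0 := by exact_mod_cast h0
    simp only [cesaro]
    rw [integral_const_mul, integral_finsetSum _ fun l _ => (hHn l).integrable one_le_two]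
    simp [hint, h0']
  have hcH : ∫ w, H w ∂P = c := by
    have h6 : Tendsto (fun L => ∫ w, cesaro (fun l => H (T^[l] w)) L ∂P - c) atTop (𝓝 0) := by
      refine squeeze_zero_norm (fun L => ?_) h1
      have : ∫ w, cesaro (fun l => H (T^[l] w)) L ∂P - c
          = ∫ w, (cesaro (fun l => H (T^[l] w)) L - c) ∂P := by
        rw [integral_sub (hi L) (integrable_const c)]; simp
      rw [this]
      exact norm_integral_le_integral_norm _
    have h7 : Tendsto (fun L => ∫ w, cesaro (fun l => H (T^[l] w)) L ∂P - c) atTop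
        (𝓝 (∫ w, H w ∂P - c)) :=
      tendsto_const_nhds.congr' ((eventually_ne_atTop 0).mono fun L h0 => by
        simp only [h5 L h0])
    exact sub_eq_zero.1 (tendsto_nhds_unique h7 h6)
  rw [hcH]
  exact h1

end MeanErgodic


/-! ### Borel maps into arbitrary metric spaces: Lusin's theorem -/

section Lusin

universe u

/-- A Borel map with separable range becomes continuous on a finer Polish space with the same Borel
sets. -/
lemma exists_polish_refinement {Ω : Type u} [t : TopologicalSpace Ω] [hP : PolishSpace Ω]
    [mΩ : MeasurableSpace Ω] [hB : BorelSpace Ω] {Y : Type*} [TopologicalSpace Y]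
    [MeasurableSpace Y] [OpensMeasurableSpace Y] {f : Ω → Y} [SecondCountableTopology (Set.range f)] (hf : Measurable f) :
    ∃ (Ω' : Type u) (_ : TopologicalSpace Ω') (_ : MeasurableSpace Ω') (_ : BorelSpace Ω')
      (_ : PolishSpace Ω') (e : Ω' ≃ᵐ Ω), Continuous e ∧ Continuous (f ∘ e) := by
  obtain ⟨t', hle, hc, hp⟩ := hf.exists_continuous
  have hb : mΩ = @borel Ω t' := by
    rw [borel_eq_borel_of_le hp hP hle]
    exact hB.measurable_eq
  exact ⟨Ω, t', mΩ, @BorelSpace.mk Ω t' mΩ hb, hp, MeasurableEquiv.refl Ω,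
    continuous_id_of_le hle, hc⟩

variable {Ω : Type u} [TopologicalSpace Ω] [PolishSpace Ω] [MeasurableSpace Ω] [BorelSpace Ω]

lemma exists_isCompact_subset_measure_compl_le (P : Measure Ω) [IsFiniteMeasure P] {A : Set Ω}
    (hA : MeasurableSet A) (hAP : P Aᶜ = 0) {δ : ENNReal} (hδ : δ ≠ 0) :
    ∃ C ⊆ A, IsCompact C ∧ P Cᶜ ≤ δ := by
  let := TopologicalSpace.upgradeIsCompletelyMetrizable Ω
  obtain ⟨C, hCA, hC, h⟩ := hA.exists_isCompact_sdiff_lt (measure_ne_top P A) hδ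
  refine ⟨C, hCA, hC, ?_⟩
  have : Cᶜ ⊆ (A \ C) ∪ Aᶜ := fun x hx => by
    by_cases hxA : x ∈ A
    · exact Or.inl ⟨hxA, hx⟩
    · exact Or.inr hxA
  calc P Cᶜ ≤ P (A \ C) + P Aᶜ := (measure_mono this).trans (measure_union_le _ _)
    _ ≤ δ := by rw [hAP, add_zero]; exact h.le

lemma countable_image_of_forall_measurableSet_preimage {X : Type*} [TopologicalSpace X]
    [PolishSpace X] {h : Ω → X} (hm : ∀ S : Set X, MeasurableSet (h ⁻¹' S)) (hc : Continuous h)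
    {C : Set Ω} (hC : IsCompact C) : (h '' C).Countable := by
  by_contra hcon
  obtain ⟨f, hfC, -, hfi⟩ :=
    (hC.image hc).isClosed.exists_nat_bool_injection_of_not_countable hcon
  -- An uncountable compact image would have as many subsets as the power set of the continuum,
  -- all with distinct Borel preimages, whereas there are only continuum many Borel sets.
  obtain ⟨b, hbc, hb⟩ := MeasurableSpace.CountablyGenerated.isCountablyGenerated (α := Ω)
  have h1 : Cardinal.mk {t : Set Ω // MeasurableSet t} ≤ Cardinal.continuum := by
    rw [hb]
    exact MeasurableSpace.cardinal_measurableSet_le_continuum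
      ((Cardinal.le_aleph0_iff_set_countable.2 hbc).trans Cardinal.aleph0_le_continuum)
  let F : Set (ℕ → Bool) → {t : Set Ω // MeasurableSet t} := fun T => ⟨h ⁻¹' (f '' T), hm _⟩
  have hF : Function.Injective F := by
    intro T T' hTT
    have h2 : h ⁻¹' (f '' T) = h ⁻¹' (f '' T') := congrArg Subtype.val hTT
    have h3 : ∀ a, (a ∈ T ↔ a ∈ T') := fun a => by
      obtain ⟨w, -, hw⟩ := hfC ⟨a, rfl⟩
      have h4 := Set.ext_iff.1 h2 w
      simpa [hw, hfi.mem_set_image] using h4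
    exact Set.ext h3
  have h2 := Cardinal.mk_le_of_injective (f := fun T : ULift.{u} (Set (ℕ → Bool)) => F T.down)
    fun a b hab => ULift.ext _ _ (hF hab)
  have h3 : Cardinal.mk (ULift.{u} (Set (ℕ → Bool))) = 2 ^ Cardinal.continuum.{u} := by
    rw [Cardinal.mk_uLift, Cardinal.mk_set]
    simp
  rw [h3] at h2
  exact absurd (h2.trans h1) (not_le.2 (Cardinal.cantor _))

/-- A map on a Polish probability space all of whose fibrewise unions are Borel takes, almost
surely, only countably many values. -/
lemma exists_countable_of_forall_measurableSet_preimage (P : Measure Ω) [IsProbabilityMeasure P]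
    {D : Type*} {g : Ω → D} (hg : ∀ S : Set D, MeasurableSet (g ⁻¹' S)) :
    ∃ S : Set D, S.Countable ∧ P (g ⁻¹' S)ᶜ = 0 := by
  have : Nonempty Ω := nonempty_of_isProbabilityMeasure P
  set s := Function.invFun g
  have hgs : ∀ w, g (s (g w)) = g w := fun w => Function.invFun_eq ⟨w, rfl⟩
  have hsg : Measurable fun w => s (g w) := fun T _ => hg (s ⁻¹' T)
  obtain ⟨Ω', _, _, _, _, e, -, hec⟩ := exists_polish_refinement hsg
  have hprob : IsProbabilityMeasure (P.map e.symm) :=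
    Measure.isProbabilityMeasure_map e.symm.measurable.aemeasurable
  have hex : ∀ n : ℕ, ∃ C ⊆ (Set.univ : Set Ω'), IsCompact C ∧
      (P.map e.symm) Cᶜ ≤ (n + 1 : ENNReal)⁻¹ := fun n =>
    exists_isCompact_subset_measure_compl_le (P.map e.symm) MeasurableSet.univ (by simp)
      (by simp)
  choose C _ hC hCP using hex
  have hcount : ∀ n, (((fun w => s (g w)) ∘ e) '' C n).Countable := fun n =>
    countable_image_of_forall_measurableSet_preimage
      (fun S => by
        have : MeasurableSet (e ⁻¹' (g ⁻¹' (s ⁻¹' S))) := e.measurable (hg _)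
        exact this) hec (hC n)
  refine ⟨⋃ n, g '' (((fun w => s (g w)) ∘ e) '' C n),
    Set.countable_iUnion fun n => (hcount n).image g, ?_⟩
  have hle : ∀ n : ℕ, P (g ⁻¹' ⋃ n, g '' (((fun w => s (g w)) ∘ e) '' C n))ᶜ
      ≤ (n + 1 : ENNReal)⁻¹ := by
    intro n
    refine le_trans ?_ (hCP n)
    rw [e.symm.map_apply]
    refine measure_mono fun w hw hwC => hw ?_
    refine Set.mem_iUnion.2 ⟨n, _, ⟨e.symm w, hwC, rfl⟩, ?_⟩
    simp [hgs]
  have h1 : Tendsto (fun n : ℕ => (n + 1 : ENNReal)⁻¹) atTop (𝓝 0) :=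
    (ENNReal.tendsto_inv_nat_nhds_zero.comp (tendsto_add_atTop_nat 1)).congr fun n => by simp
  exact nonpos_iff_eq_zero.1 (ge_of_tendsto' h1 hle)

/-- A discretization of a metric space at scale `ε` such that all unions of its cells are Borel:
every point is sent to the first point, for a well-ordering, at distance less than `ε`. -/
lemma exists_discretization (Y : Type*) [MetricSpace Y] [MeasurableSpace Y] [BorelSpace Y] {ε : ℝ}
    (hε : 0 < ε) :
    ∃ d : Y → Y, (∀ y, dist y (d y) < ε) ∧ ∀ S : Set Y, MeasurableSet (d ⁻¹' S) := by
  obtain ⟨_, hwf⟩ := exists_wellFoundedLT Y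
  have hne : ∀ y : Y, {c | dist y c < ε}.Nonempty := fun y => ⟨y, by simpa using hε⟩
  set d : Y → Y := fun y => hwf.wf.min {c | dist y c < ε} (hne y) with hd
  have hdε : ∀ y, dist y (d y) < ε := fun y => hwf.wf.min_mem _ (hne y)
  have hmin : ∀ y c, c < d y → ε ≤ dist y c := fun y c hc => by
    by_contra hlt
    exact hwf.wf.not_lt_min {c | dist y c < ε} (not_le.1 hlt) hc
  refine ⟨d, hdε, fun S => ?_⟩
  let A : ℕ → Y → Set Y := fun n c =>
    {y | dist y c ≤ ε - 1 / ((n : ℝ) + 1) ∧ ∀ c' < c, ε ≤ dist y c'}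
  have hA : ∀ n c, IsClosed (A n c) := fun n c => by
    have h : A n c = {y | dist y c ≤ ε - 1 / ((n : ℝ) + 1)} ∩ ⋂ c', ⋂ (_ : c' < c),
        {y | ε ≤ dist y c'} := by
      ext; simp [A]
    rw [h]
    exact (isClosed_le (continuous_id.dist continuous_const) continuous_const).inter
      (isClosed_iInter fun c' => isClosed_iInter fun _ =>
        isClosed_le continuous_const (continuous_id.dist continuous_const))
  -- For fixed `n`, the sets `A n c` are uniformly separated from each other.
  have hsep : ∀ n c₁ c₂ y₁ y₂, y₁ ∈ A n c₁ → y₂ ∈ A n c₂ → dist y₁ y₂ < 1 / ((n : ℝ) + 1) →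
      ¬ c₁ < c₂ := by
    intro n c₁ c₂ y₁ y₂ h1 h2 h12 hlt
    have h3 := h2.2 c₁ hlt
    have h4 := dist_triangle_left y₂ c₁ y₁
    linarith [h1.1]
  have hU : ∀ n, IsClosed (⋃ c ∈ S, A n c) := by
    intro n
    have hn : (0 : ℝ) < 1 / ((n : ℝ) + 1) := by positivity
    refine isClosed_of_closure_subset fun y hy => ?_
    rw [Metric.mem_closure_iff] at hy
    obtain ⟨y₁, hy₁, hd₁⟩ := hy (1 / ((n : ℝ) + 1) / 2) (by positivity)
    obtain ⟨c₁, hc₁S, hc₁⟩ := Set.mem_iUnion₂.1 hy₁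
    refine Set.mem_iUnion₂.2 ⟨c₁, hc₁S, ?_⟩
    rw [← (hA n c₁).closure_eq, Metric.mem_closure_iff]
    intro δ hδ
    obtain ⟨y₂, hy₂, hd₂⟩ := hy (min δ (1 / ((n : ℝ) + 1) / 2)) (by positivity)
    obtain ⟨c₂, hc₂S, hc₂⟩ := Set.mem_iUnion₂.1 hy₂
    have h12 : dist y₁ y₂ < 1 / ((n : ℝ) + 1) := by
      have := dist_triangle_left y₁ y₂ y
      have := lt_min_iff.1 hd₂
      linarith
    have hcc : c₁ = c₂ := le_antisymm
      (not_lt.1 (hsep n c₂ c₁ y₂ y₁ hc₂ hc₁ (by rwa [dist_comm])))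
      (not_lt.1 (hsep n c₁ c₂ y₁ y₂ hc₁ hc₂ h12))
    exact ⟨y₂, hcc ▸ hc₂, (lt_min_iff.1 hd₂).1⟩
  have hS : d ⁻¹' S = ⋃ n, ⋃ c ∈ S, A n c := by
    ext y
    simp only [Set.mem_preimage, Set.mem_iUnion, exists_prop]
    constructor
    · intro hy
      obtain ⟨n, hn⟩ := exists_nat_one_div_lt (sub_pos.2 (hdε y))
      exact ⟨n, d y, hy, by linarith, hmin y⟩
    · rintro ⟨n, c, hcS, hc⟩
      have hn : (0 : ℝ) < 1 / ((n : ℝ) + 1) := by positivity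
      have h1 : d y = c := by
        refine le_antisymm (not_lt.1 fun h => ?_) (not_lt.1 fun h => ?_)
        · have := hmin y c h
          linarith [hc.1]
        · have := hc.2 _ h
          linarith [hdε y]
      rwa [h1]
  rw [hS]
  exact MeasurableSet.iUnion fun n => (hU n).measurableSet

/-- **Lusin's theorem** for Borel maps from a Polish probability space to a metric space, which need
not be separable. -/
theorem exists_isCompact_continuousOn (P : Measure Ω) [IsProbabilityMeasure P] {Y : Type*}
    [MetricSpace Y] [MeasurableSpace Y] [BorelSpace Y] {f : Ω → Y} (hf : Measurable f)
    {δ : ENNReal} (hδ : δ ≠ 0) : ∃ C, IsCompact C ∧ ContinuousOn f C ∧ P Cᶜ ≤ δ := by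
  have : Nonempty Ω := nonempty_of_isProbabilityMeasure P
  choose d hd hdm using fun n : ℕ =>
    exists_discretization Y (ε := 1 / ((n : ℝ) + 1)) (by positivity)
  choose S hSc hSP using fun n => exists_countable_of_forall_measurableSet_preimage P
    (g := fun w => d n (f w)) (fun T => hf (hdm n T))
  set Y' : Set Y := closure (⋃ n, S n) with hY'
  have hsep : TopologicalSpace.IsSeparable Y' :=
    (Set.countable_iUnion hSc).isSeparable.closure
  have hA : MeasurableSet (f ⁻¹' Y') := hf isClosed_closure.measurableSet
  have hAP : P (f ⁻¹' Y')ᶜ = 0 := by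
    refine measure_mono_null ?_ (measure_iUnion_null hSP)
    intro w hw
    by_contra hcon
    simp only [Set.mem_iUnion, Set.mem_compl_iff, Set.mem_preimage, not_exists, not_not] at hcon
    refine hw (Metric.mem_closure_iff.2 fun ε hε => ?_)
    obtain ⟨n, hn⟩ := exists_nat_one_div_lt hε
    exact ⟨_, Set.mem_iUnion.2 ⟨n, hcon n⟩, (hd n _).trans hn⟩
  obtain ⟨w₀, hw₀⟩ : (f ⁻¹' Y').Nonempty := by
    by_contra hne
    rw [Set.not_nonempty_iff_eq_empty.1 hne] at hAP
    simp at hAP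
  classical
  set f' : Ω → Y := fun w => if w ∈ f ⁻¹' Y' then f w else f w₀ with hf'
  have hf'm : Measurable f' := Measurable.ite hA hf measurable_const
  have hrange : Set.range f' ⊆ Y' := by
    rintro _ ⟨w, rfl⟩
    simp only [hf']
    split_ifs with h
    exacts [h, hw₀]
  have := (hsep.mono hrange).secondCountableTopology
  obtain ⟨Ω', _, _, _, _, e, hec, hfc⟩ := exists_polish_refinement hf'm
  have hprob : IsProbabilityMeasure (P.map e.symm) :=
    Measure.isProbabilityMeasure_map e.symm.measurable.aemeasurable
  obtain ⟨C, hCA, hC, hCP⟩ := exists_isCompact_subset_measure_compl_le (P.map e.symm)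
    (e.measurable hA) (by
      rw [e.symm.map_apply, ← hAP]
      congr 1; ext w; simp) hδ
  refine ⟨e '' C, hC.image hec, ?_, ?_⟩
  · rw [continuousOn_iff_isClosed]
    intro F hF
    refine ⟨e '' (C ∩ (f' ∘ e) ⁻¹' F),
      ((hC.inter_right (hF.preimage hfc)).image hec).isClosed, ?_⟩
    ext w
    simp only [Set.mem_inter_iff, Set.mem_preimage, Set.mem_image, Function.comp]
    constructor
    · rintro ⟨hwF, v, hv, rfl⟩
      refine ⟨⟨v, ⟨hv, ?_⟩, rfl⟩, v, hv, rfl⟩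
      simpa only [hf', if_pos (show e v ∈ f ⁻¹' Y' from hCA hv)] using hwF
    · rintro ⟨⟨v, ⟨hv, hvF⟩, rfl⟩, -⟩
      refine ⟨?_, v, hv, rfl⟩
      simpa only [hf', if_pos (show e v ∈ f ⁻¹' Y' from hCA hv)] using hvF
  · rw [e.symm.map_apply] at hCP
    refine le_trans (le_of_eq ?_) hCP
    congr 1
    ext w
    simp only [Set.mem_compl_iff, Set.mem_image, Set.mem_preimage, not_iff_not]
    exact ⟨fun ⟨v, hv, h⟩ => by rw [← h]; simpa using hv, fun h => ⟨_, h, by simp⟩⟩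

end Lusin


/-! ### Equidistribution of the walk together with its future -/

section Cutoff

/-- A continuous function on a compact space of sequences depends on only finitely many
coordinates, up to `ε`. -/
lemma exists_finset_forall_eq_imp_abs_sub_le {Q E ι : Type*} [TopologicalSpace Q] [CompactSpace Q]
    [TopologicalSpace E] [CompactSpace E] [T2Space E] {h : Q × (ι → E) → ℝ} (hc : Continuous h)
    {ε : ℝ} (hε : 0 < ε) :
    ∃ s : Finset ι, ∀ q b b', (∀ i ∈ s, b i = b' i) → |h (q, b) - h (q, b')| ≤ ε := by
  classical
  let K : Finset ι → Set (Q × (ι → E) × (ι → E)) := fun s =>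
    {w | (∀ i ∈ s, w.2.1 i = w.2.2 i) ∧ ε ≤ |h (w.1, w.2.1) - h (w.1, w.2.2)|}
  have hK : ∀ s, IsClosed (K s) := fun s => by
    have e : K s = (⋂ i ∈ s, {w | w.2.1 i = w.2.2 i}) ∩
        {w | ε ≤ |h (w.1, w.2.1) - h (w.1, w.2.2)|} := by ext; simp [K]
    rw [e]
    refine IsClosed.inter (isClosed_biInter fun i _ => isClosed_eq (by fun_prop) (by fun_prop)) ?_
    exact isClosed_le continuous_const (by fun_prop)
  obtain ⟨s, hs⟩ := (isCompact_univ (X := Q × (ι → E) × (ι → E))).elim_directed_family_closed K hK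
    (by
      rw [Set.univ_inter, Set.eq_empty_iff_forall_notMem]
      rintro ⟨q, b, b'⟩ hw
      rw [Set.mem_iInter] at hw
      have hbb : b = b' := funext fun i => (hw {i}).1 i (Finset.mem_singleton_self i)
      have := (hw ∅).2
      simp only [hbb, sub_self, abs_zero] at this
      linarith)
    (directed_of_isDirected_le fun s t hst w hw =>
      ⟨fun i hi => hw.1 i (Finset.subset_iff.1 hst hi), hw.2⟩)
  refine ⟨s, fun q b b' hbb => ?_⟩
  by_contra hcon
  have : (q, b, b') ∈ Set.univ ∩ K s := ⟨trivial, hbb, (not_le.1 hcon).le⟩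
  rw [hs] at this
  exact this

variable {X : Type*} [TopologicalSpace X] [T2Space X] [LocallyCompactSpace X]
  [SecondCountableTopology X] [MeasurableSpace X] [BorelSpace X]
  (mX : Measure X) [IsProbabilityMeasure mX]

lemma integrable_of_continuous_of_bound {W : Type*} [TopologicalSpace W] [MeasurableSpace W]
    [OpensMeasurableSpace W] {P : Measure W} [IsFiniteMeasure P] {φ : W → ℝ} (hc : Continuous φ)
    {M : ℝ} (hM : ∀ x, |φ x| ≤ M) : Integrable φ P :=
  Integrable.of_bound hc.measurable.aestronglyMeasurable M (ae_of_all _ hM)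

lemma exists_cutoff {ε : ℝ} (hε : 0 < ε) : ∃ χ : X → ℝ, Continuous χ ∧ HasCompactSupport χ ∧
    (∀ x, 0 ≤ χ x) ∧ (∀ x, χ x ≤ 1) ∧ 1 - ε ≤ ∫ x, χ x ∂mX := by
  have h1 := tendsto_measure_iUnion_atTop (μ := mX)
    (monotone_nat_of_le_succ (CompactExhaustion.choice X).subset_succ)
  rw [(CompactExhaustion.choice X).iUnion_eq, measure_univ] at h1
  have h2 := (ENNReal.tendsto_toReal ENNReal.one_ne_top).comp h1
  obtain ⟨n, hn⟩ := ((tendsto_order.1 h2).1 (1 - ε) (by simpa using hε)).exists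
  have hK := (CompactExhaustion.choice X).isCompact n
  obtain ⟨χ, hχ1, -, hχc, hχ⟩ := exists_continuous_one_zero_of_isCompact hK isClosed_empty
    (Set.disjoint_empty _)
  refine ⟨χ, χ.continuous, hχc, fun x => (hχ x).1, fun x => (hχ x).2, ?_⟩
  have h3 : mX.real (CompactExhaustion.choice X n) ≤ ∫ x, χ x ∂mX := by
    rw [← integral_indicator_one hK.measurableSet]
    refine integral_mono ((integrable_const (1 : ℝ)).indicator hK.measurableSet)
      (integrable_of_continuous_of_bound χ.continuous (M := 1) fun x => by
        rw [abs_of_nonneg (hχ x).1]; exact (hχ x).2) fun x => ?_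
    by_cases hx : x ∈ (CompactExhaustion.choice X n : Set X)
    · simp only [Set.indicator_of_mem hx, Pi.one_apply]
      exact (hχ1 hx).ge
    · rw [Set.indicator_of_notMem hx]
      exact (hχ x).1
  exact hn.le.trans h3

lemma Equidistributed.tendsto_cesaro {Z : Type*} [TopologicalSpace Z] [MeasurableSpace Z]
    {u : ℕ → Z} {m : Measure Z} (h : Equidistributed u m) {φ : Z → ℝ} (hc : Continuous φ) {M : ℝ}
    (hM : ∀ x, |φ x| ≤ M) : Tendsto (cesaro fun n => φ (u n)) atTop (𝓝 (∫ z, φ z ∂m)) :=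
  h (BoundedContinuousFunction.ofNormedAddCommGroup φ hc M hM)

end Cutoff

section Future

variable {E : Type*} [TopologicalSpace E] [CompactSpace E] [T2Space E] [SecondCountableTopology E]
  [MeasurableSpace E] [BorelSpace E] (ν : Measure E) [IsProbabilityMeasure ν]
  {X : Type*} [TopologicalSpace X] [T2Space X] [LocallyCompactSpace X]
  [SecondCountableTopology X] [MeasurableSpace X] [BorelSpace X]
  {mX : Measure X} [IsProbabilityMeasure mX] {act : E → X → X}

lemma continuous_orbit {E X : Type*} [TopologicalSpace E] [TopologicalSpace X] {act : E → X → X}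
    (hact : Continuous fun p : E × X => act p.1 p.2) (n : ℕ) :
    Continuous fun w : (ℕ → E) × X => orbit act w.1 w.2 n := by
  induction n with
  | zero => exact continuous_snd
  | succ n ih =>
    exact hact.comp (((continuous_apply n).comp continuous_fst).prodMk ih)

/-- Law of large numbers: a function of the position and of the next `p` letters may be replaced,
on average, by its mean over these letters. -/
lemma ae_tendsto_cesaro_sub_integral {E X : Type*} [MeasurableSpace E] [MeasurableSpace X]
    (ν : Measure E) [IsProbabilityMeasure ν] {act : E → X → X}
    (hact : Measurable fun p : E × X => act p.1 p.2) (x : X)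
    {h : X × (ℕ → E) → ℝ} (hm : Measurable h) {M : ℝ} (hM : ∀ w, |h w| ≤ M) {p : ℕ}
    (hp : ∀ y b b', (∀ i < p, b i = b' i) → h (y, b) = h (y, b')) :
    ∀ᵐ b ∂(Measure.infinitePi fun _ : ℕ => ν),
      Tendsto (cesaro fun n => h (orbit act b x n, fun i => b (i + n)) -
        ∫ c, h (orbit act b x n, c) ∂(Measure.infinitePi fun _ : ℕ => ν)) atTop (𝓝 0) := by
  set β : Measure (ℕ → E) := Measure.infinitePi fun _ => ν with hβ
  have hbar : Measurable fun y => ∫ c, h (y, c) ∂β :=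
    hm.stronglyMeasurable.integral_prod_right'.measurable
  have hbarM : ∀ y, |∫ c, h (y, c) ∂β| ≤ M := fun y => by
    have := norm_integral_le_of_norm_le_const (μ := β) (C := M) (f := fun c => h (y, c))
      (ae_of_all _ fun c => hM _)
    simpa using this
  have horb : ∀ n, Measurable fun b : ℕ → E => orbit act b x n := fun n =>
    (measurable_orbit hact n).comp (measurable_id.prodMk measurable_const)
  have hsh : ∀ n, Measurable fun (b : ℕ → E) (i : ℕ) => b (i + n) := fun n =>
    measurable_pi_lambda _ fun i => measurable_pi_apply _
  refine ae_tendsto_cesaro_zero (M := 2 * M) (p := p)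
    (ξ := fun n b => h (orbit act b x n, fun i => b (i + n)) - ∫ c, h (orbit act b x n, c) ∂β)
    (fun n => (hm.comp ((horb n).prodMk (hsh n))).sub (hbar.comp (horb n))) (fun n b => ?_)
    fun l n hln => ?_
  · refine (abs_sub _ _).trans ?_
    linarith [hM (orbit act b x n, fun i => b (i + n)), hbarM (orbit act b x n)]
  · set ξ : ℕ → (ℕ → E) → ℝ :=
      fun n b => h (orbit act b x n, fun i => b (i + n)) - ∫ c, h (orbit act b x n, c) ∂β with hξ
    have hξm : ∀ n, Measurable (ξ n) := fun n =>
      (hm.comp ((horb n).prodMk (hsh n))).sub (hbar.comp (horb n))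
    have hξM : ∀ n b, |ξ n b| ≤ 2 * M := fun n b => by
      refine (abs_sub _ _).trans ?_
      linarith [hM (orbit act b x n, fun i => b (i + n)), hbarM (orbit act b x n)]
    have hl : ∀ c b, ξ l (join n c b) = ξ l c := fun c b => by
      have e1 : orbit act (join n c b) x l = orbit act c x l :=
        orbit_congr (fun i hi => join_of_lt c b (by omega)) x
      simp only [hξ, e1]
      rw [hp (orbit act c x l) (fun i => join n c b (i + l)) (fun i => c (i + l))
        fun i hi => join_of_lt c b (by omega)]
    have hn : ∀ c b, ξ n (join n c b) =
        h (orbit act c x n, b) - ∫ c', h (orbit act c x n, c') ∂β := fun c b => by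
      have e1 : orbit act (join n c b) x n = orbit act c x n :=
        orbit_congr (fun i hi => join_of_lt c b hi) x
      simp only [hξ, e1, join_add]
    have hmul : Measurable fun b => ξ l b * ξ n b := (hξm l).mul (hξm n)
    have h1 := integral_comp_measurePreserving (measurePreserving_join ν n)
      (g := fun b => ξ l b * ξ n b) hmul.aestronglyMeasurable
    change ∫ b, ξ l b * ξ n b ∂β = 0
    rw [← h1, integral_prod]
    · refine integral_eq_zero_of_ae (ae_of_all _ fun c => ?_)
      simp only [hl, hn]
      have hi : Integrable (fun b => h (orbit act c x n, b)) β :=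
        Integrable.of_bound (hm.comp (measurable_const.prodMk measurable_id)).aestronglyMeasurable M
          (ae_of_all _ fun b => hM _)
      rw [integral_const_mul, integral_sub hi (integrable_const _)]
      simp
    · refine Integrable.of_bound (hmul.comp (measurable_join n)).aestronglyMeasurable
        (2 * M * (2 * M)) (ae_of_all _ fun q => ?_)
      rw [Real.norm_eq_abs, abs_mul]
      exact mul_le_mul (hξM _ _) (hξM _ _) (abs_nonneg _) ((abs_nonneg _).trans (hξM l q.1))

lemma ae_tendsto_cesaro_of_hasCompactSupport (hact : Continuous fun p : E × X => act p.1 p.2)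
    (x : X) (hx : ∀ᵐ b ∂(Measure.infinitePi fun _ : ℕ => ν), Equidistributed (orbit act b x) mX)
    {h : X × (ℕ → E) → ℝ} (hc : Continuous h) (hs : HasCompactSupport h) :
    ∀ᵐ b ∂(Measure.infinitePi fun _ : ℕ => ν),
      Tendsto (cesaro fun n => h (orbit act b x n, fun i => b (i + n))) atTop
        (𝓝 (∫ w, h w ∂(mX.prod (Measure.infinitePi fun _ : ℕ => ν)))) := by
  classical
  set β : Measure (ℕ → E) := Measure.infinitePi fun _ => ν with hβ
  obtain ⟨e₀⟩ : Nonempty E := nonempty_of_isProbabilityMeasure ν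
  obtain ⟨M, hM⟩ := hs.exists_bound_of_continuous hc
  let τ : ℕ → (ℕ → E) → ℕ → E := fun p b i => if i < p then b i else e₀
  have hτ : ∀ p, Continuous (τ p) := fun p => continuous_pi fun i => by
    by_cases hi : i < p
    · simpa only [τ, if_pos hi] using continuous_apply i
    · simpa only [τ, if_neg hi] using continuous_const
  let hp : ℕ → X × (ℕ → E) → ℝ := fun p w => h (w.1, τ p w.2)
  have hpc : ∀ p, Continuous (hp p) := fun p =>
    hc.comp (continuous_fst.prodMk ((hτ p).comp continuous_snd))
  have hpM : ∀ p w, |hp p w| ≤ M := fun p w => hM _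
  have hlln : ∀ᵐ b ∂β, ∀ p, Tendsto (cesaro fun n => hp p (orbit act b x n, fun i => b (i + n)) -
      ∫ c, hp p (orbit act b x n, c) ∂β) atTop (𝓝 0) := by
    refine ae_all_iff.2 fun p => ae_tendsto_cesaro_sub_integral ν hact.measurable x
      (hpc p).measurable (hpM p) (p := p) fun y b b' hbb => ?_
    have : τ p b = τ p b' := by
      ext i
      by_cases hi : i < p
      · simp only [τ, if_pos hi, hbb i hi]
      · simp only [τ, if_neg hi]
    simp only [hp, this]
  filter_upwards [hlln, hx] with b hb hbx
  refine (tendsto_cesaro_of_approx (P := mX.prod β)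
    (w := fun n => (orbit act b x n, fun i => b (i + n))) fun ε hε => ?_).2
  -- Only the first `p` letters matter, uniformly over the compact support.
  have hQ : IsCompact (Prod.fst '' tsupport h) := hs.isCompact.image continuous_fst
  have : CompactSpace (Prod.fst '' tsupport h) := isCompact_iff_compactSpace.1 hQ
  obtain ⟨s, hs'⟩ := exists_finset_forall_eq_imp_abs_sub_le
    (h := fun w : (Prod.fst '' tsupport h) × (ℕ → E) => h (w.1, w.2)) (by fun_prop) hε
  set p := s.sup id + 1
  have happ : ∀ w, |h w - hp p w| ≤ ε := by
    rintro ⟨y, c⟩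
    by_cases hy : y ∈ Prod.fst '' tsupport h
    · refine hs' ⟨y, hy⟩ c (τ p c) fun i hi => ?_
      have : i < p := Nat.lt_succ_of_le (Finset.le_sup (f := id) hi)
      simp only [τ, if_pos this]
    · have h0 : ∀ c', h (y, c') = 0 := fun c' =>
        image_eq_zero_of_notMem_tsupport fun hmem => hy ⟨_, hmem, rfl⟩
      simp only [hp, h0, sub_self, abs_zero]
      exact hε.le
  refine ⟨hp p, fun _ => ε, happ, integrable_of_continuous_of_bound (hpc p) (hpM p),
    integrable_const ε, ?_, ?_, by simp⟩
  · have hbar : Continuous fun y => ∫ c, hp p (y, c) ∂β :=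
      continuous_of_dominated
        (fun y => ((hpc p).comp
          (by fun_prop : Continuous fun c => (y, c))).measurable.aestronglyMeasurable)
        (fun y => ae_of_all _ fun c => hpM p _) (integrable_const M)
        (ae_of_all _ fun c => (hpc p).comp (by fun_prop : Continuous fun y => (y, c)))
    have h1 := hbx.tendsto_cesaro hbar (M := M) fun y => by
      have := norm_integral_le_of_norm_le_const (μ := β) (C := M) (f := fun c => hp p (y, c))
        (ae_of_all _ fun c => hpM p _)
      simpa using this
    have h2 := (hb p).add h1
    rw [zero_add, ← integral_prod _ (integrable_of_continuous_of_bound (hpc p) (hpM p))] at h2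
    refine h2.congr fun N => ?_
    rw [← cesaro_add]
    simp
  · filter_upwards [eventually_ne_atTop 0] with N hN
    exact (cesaro_const ε hN).le

/-- If almost every trajectory of the walk from `x` is equidistributed, then so is almost every
trajectory together with its sequence of future letters. -/
theorem ae_equidistributed_orbit_future (hact : Continuous fun p : E × X => act p.1 p.2) (x : X)
    (hx : ∀ᵐ b ∂(Measure.infinitePi fun _ : ℕ => ν), Equidistributed (orbit act b x) mX) :
    ∀ᵐ b ∂(Measure.infinitePi fun _ : ℕ => ν),
      Equidistributed (fun n => (orbit act b x n, fun i => b (i + n)))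
        (mX.prod (Measure.infinitePi fun _ : ℕ => ν)) := by
  set β : Measure (ℕ → E) := Measure.infinitePi fun _ => ν with hβ
  choose χ hχc hχs hχ0 hχ1 hχi using fun j : ℕ =>
    exists_cutoff mX (ε := 1 / ((j : ℝ) + 1)) (by positivity)
  have hχM : ∀ j y, |χ j y| ≤ 1 := fun j y => by rw [abs_of_nonneg (hχ0 j y)]; exact hχ1 j y
  let g : ℕ → C(X × (ℕ → E), ℝ) := TopologicalSpace.denseSeq _
  have hfam : ∀ᵐ b ∂β, ∀ i j, Tendsto
      (cesaro fun n => χ j (orbit act b x n) * g i (orbit act b x n, fun i => b (i + n))) atTop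
        (𝓝 (∫ w, χ j w.1 * g i w ∂(mX.prod β))) := by
    refine ae_all_iff.2 fun i => ae_all_iff.2 fun j => ?_
    refine ae_tendsto_cesaro_of_hasCompactSupport ν hact x hx
      (h := fun w => χ j w.1 * g i w) (by fun_prop) ?_
    refine HasCompactSupport.intro ((hχs j).isCompact.prod isCompact_univ) fun w hw => ?_
    have : w.1 ∉ tsupport (χ j) := fun h => hw ⟨h, trivial⟩
    rw [image_eq_zero_of_notMem_tsupport this, zero_mul]
  filter_upwards [hfam, hx] with b hb hbx φ
  have hφM : ∀ w, |φ w| ≤ ‖φ‖ := φ.norm_coe_le_norm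
  refine (tendsto_cesaro_of_approx (P := mX.prod β)
    (w := fun n => (orbit act b x n, fun i => b (i + n))) fun ε hε => ?_).2
  obtain ⟨j, hj⟩ := exists_nat_one_div_lt (show 0 < ε / 4 / (‖φ‖ + 1) by positivity)
  have hK : IsCompact (tsupport (χ j) ×ˢ (Set.univ : Set (ℕ → E))) :=
    (hχs j).isCompact.prod isCompact_univ
  obtain ⟨i, hi⟩ : ∃ i, ∀ w ∈ tsupport (χ j) ×ˢ (Set.univ : Set (ℕ → E)),
      |φ w - g i w| ≤ ε / 2 := by
    have : CompactSpace ↥(tsupport (χ j) ×ˢ (Set.univ : Set (ℕ → E))) :=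
      isCompact_iff_compactSpace.1 hK
    have hopen := (Metric.isOpen_ball (x := (φ : C(X × (ℕ → E), ℝ)).restrict
      (tsupport (χ j) ×ˢ (Set.univ : Set (ℕ → E)))) (ε := ε / 2)).preimage
      (ContinuousMap.continuous_restrict (Y := ℝ) (tsupport (χ j) ×ˢ (Set.univ : Set (ℕ → E))))
    obtain ⟨i, hi⟩ := (TopologicalSpace.denseRange_denseSeq C(X × (ℕ → E), ℝ)).exists_mem_open hopen
      ⟨(φ : C(X × (ℕ → E), ℝ)), by simpa using hε⟩
    refine ⟨i, fun w hw => ?_⟩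
    have := (ContinuousMap.dist_apply_le_dist ⟨w, hw⟩).trans (Metric.mem_ball.1 hi).le
    rw [dist_comm, Real.dist_eq] at this
    exact this
  have hr : Continuous fun w : X × (ℕ → E) => ε / 2 + ‖φ‖ * (1 - χ j w.1) := by fun_prop
  have hsmall : ‖φ‖ * (1 / ((j : ℝ) + 1)) ≤ ε / 4 := by
    rw [lt_div_iff₀ (by positivity)] at hj
    have : (0 : ℝ) < 1 / ((j : ℝ) + 1) := by positivity
    nlinarith [norm_nonneg φ]
  have hΨM : ∀ w : X × (ℕ → E), |χ j w.1 * g i w| ≤ ‖φ‖ + ε / 2 := fun w => by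
    by_cases hw : w.1 ∈ tsupport (χ j)
    · have h1 := hi w ⟨hw, trivial⟩
      have h2 := hφM w
      have h3 : |g i w| ≤ ‖φ‖ + ε / 2 := by
        rw [abs_le] at *
        constructor <;> linarith [h1.1, h1.2, h2.1, h2.2]
      rw [abs_mul]
      exact (mul_le_of_le_one_left (abs_nonneg _) (hχM j _)).trans h3
    · rw [image_eq_zero_of_notMem_tsupport hw, zero_mul, abs_zero]
      positivity
  have hrM : ∀ w : X × (ℕ → E), |ε / 2 + ‖φ‖ * (1 - χ j w.1)| ≤ ε / 2 + ‖φ‖ := fun w => by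
    have h0 := hχ0 j w.1
    have h1 := hχ1 j w.1
    have h2 : 0 ≤ ‖φ‖ * (1 - χ j w.1) := mul_nonneg (norm_nonneg _) (by linarith)
    rw [abs_of_nonneg (by linarith)]
    nlinarith [norm_nonneg φ]
  refine ⟨fun w => χ j w.1 * g i w, fun w => ε / 2 + ‖φ‖ * (1 - χ j w.1), fun w => ?_,
    integrable_of_continuous_of_bound (by fun_prop) hΨM,
    integrable_of_continuous_of_bound hr hrM, hb i j, ?_, ?_⟩
  · have h0 := hχ0 j w.1
    have h1 := hχ1 j w.1
    have e : φ w - χ j w.1 * g i w = χ j w.1 * (φ w - g i w) + φ w * (1 - χ j w.1) := by ring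
    rw [e]
    refine (abs_add_le _ _).trans (add_le_add ?_ ?_)
    · by_cases hw : w.1 ∈ tsupport (χ j)
      · rw [abs_mul]
        exact (mul_le_of_le_one_left (abs_nonneg _) (hχM j _)).trans (hi w ⟨hw, trivial⟩)
      · rw [image_eq_zero_of_notMem_tsupport hw, zero_mul, abs_zero]
        positivity
    · rw [abs_mul, abs_of_nonneg (by linarith : 0 ≤ 1 - χ j w.1)]
      exact mul_le_mul_of_nonneg_right (hφM w) (by linarith)
  · have h1 := hbx.tendsto_cesaro (hχc j) (hχM j)
    have h2 : Tendsto (cesaro fun n => ε / 2 + ‖φ‖ * (1 - χ j (orbit act b x n))) atTop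
        (𝓝 (ε / 2 + ‖φ‖ * (1 - ∫ y, χ j y ∂mX))) := by
      have h3 := (tendsto_cesaro_const (ε / 2)).add
        (((tendsto_cesaro_const 1).sub h1).const_mul ‖φ‖)
      refine h3.congr fun N => ?_
      rw [← cesaro_sub, ← cesaro_const_mul, ← cesaro_add]
    refine ((tendsto_order.1 h2).2 ε ?_).mono fun N hN => hN.le
    have := hχi j
    nlinarith [norm_nonneg φ]
  · have h1 : ∫ w, (ε / 2 + ‖φ‖ * (1 - χ j w.1)) ∂(mX.prod β)
        = ε / 2 + ‖φ‖ * (1 - ∫ y, χ j y ∂mX) := by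
      have hχint : Integrable (χ j) mX := integrable_of_continuous_of_bound (hχc j) (hχM j)
      have hi' : Integrable (fun y => ‖φ‖ * (1 - χ j y)) mX :=
        ((integrable_const (1 : ℝ)).sub hχint).const_mul _
      have e := integral_fun_fst (μ := mX) (ν := β) (fun y => ε / 2 + ‖φ‖ * (1 - χ j y))
      rw [e, integral_add (integrable_const _) hi', integral_const_mul,
        integral_sub (integrable_const _) hχint]
      simp
    rw [h1]
    have := hχi j
    nlinarith [norm_nonneg φ]

end Future


/-! ### Lifting equidistribution to a compact group extension -/

section Extension

/-- The action of the letters on the compact extension: `e (x, k) = (e x, τ(e) k)`. -/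
def extAct {E X K : Type*} [Mul K] (act : E → X → X) (τ : E → K) (e : E) (z : X × K) : X × K :=
  (act e z.1, τ e * z.2)

lemma orbit_extAct_fst {E X K : Type*} [Mul K] (act : E → X → X) (τ : E → K) (b : ℕ → E)
    (z : X × K) (n : ℕ) : (orbit (extAct act τ) b z n).1 = orbit act b z.1 n := by
  induction n with
  | zero => rfl
  | succ n ih => simp only [orbit, extAct, ih]

lemma orbit_extAct_mul_right {E X K : Type*} [Group K] (act : E → X → X) (τ : E → K) (b : ℕ → E)
    (x : X) (k h : K) (n : ℕ) : orbit (extAct act τ) b (x, k * h) n =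
      ((orbit (extAct act τ) b (x, k) n).1, (orbit (extAct act τ) b (x, k) n).2 * h) := by
  induction n with
  | zero => rfl
  | succ n ih => simp only [orbit, extAct, ih, mul_assoc]

lemma continuous_extAct {E X K : Type*} [TopologicalSpace E] [TopologicalSpace X]
    [TopologicalSpace K] [Group K] [IsTopologicalGroup K] {act : E → X → X}
    (hact : Continuous fun p : E × X => act p.1 p.2) {τ : E → K} (hτ : Continuous τ) :
    Continuous fun p : E × (X × K) => extAct act τ p.1 p.2 := by
  have h1 : Continuous fun p : E × (X × K) => act p.1 p.2.1 :=
    hact.comp (continuous_fst.prodMk (continuous_fst.comp continuous_snd))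
  exact h1.prodMk ((hτ.comp continuous_fst).mul (continuous_snd.comp continuous_snd))

lemma continuous_skew {E Z : Type*} [TopologicalSpace E] [TopologicalSpace Z] {act : E → Z → Z}
    (hact : Continuous fun p : E × Z => act p.1 p.2) : Continuous (skew act) := by
  have h0 : Continuous fun w : (ℕ → E) × Z => (w.1 0, w.2) := by fun_prop
  have h1 : Continuous fun w : (ℕ → E) × Z => act (w.1 0) w.2 := hact.comp h0
  exact Continuous.prodMk (continuous_pi fun i => (continuous_apply _).comp continuous_fst) h1

lemma abs_cesaro_le {a : ℕ → ℝ} {M : ℝ} (hM0 : 0 ≤ M) (hM : ∀ n, |a n| ≤ M) (N : ℕ) :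
    |cesaro a N| ≤ M := by
  rcases eq_or_ne N 0 with rfl | hN
  · simpa [cesaro] using hM0
  · have h1 := abs_cesaro_sub_le (a := a) (b := fun _ => 0) (r := fun _ => M)
      (fun n => by simpa using hM n) N
    rwa [cesaro_const M hN, cesaro_const 0 hN, sub_zero] at h1

variable {E : Type*} [TopologicalSpace E] [SecondCountableTopology E]
  [MeasurableSpace E] [BorelSpace E] {ν : Measure E} [IsProbabilityMeasure ν]
  {X : Type*} [TopologicalSpace X]
  [SecondCountableTopology X] [MeasurableSpace X] [BorelSpace X]
  {mX : Measure X} [IsProbabilityMeasure mX] {act : E → X → X}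
  {K : Type*} [Group K] [TopologicalSpace K] [IsTopologicalGroup K]
  [MeasurableSpace K] [BorelSpace K] {mK : Measure K} [mK.IsHaarMeasure] [IsProbabilityMeasure mK]
  {τ : E → K}

/-- The function `u` is right uniformly continuous in the group variable, uniformly in the other
variable. -/
def RightEquicontinuous {W K : Type*} [Group K] [TopologicalSpace K] (u : W → K → ℝ) : Prop :=
  ∀ ε > 0, ∃ U ∈ 𝓝 (1 : K), ∀ h ∈ U, ∀ x k, |u x (k * h) - u x k| ≤ ε

/-- Pointwise control of a function that is almost invariant under right translation by `U`, in
terms of its integral over the group. -/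
lemma abs_sub_le_add_integral {D : K → ℝ} (hD : Measurable D) {M : ℝ} (hM : ∀ k, |D k| ≤ M)
    {c ε : ℝ} {U : Set K} (hU : U ∈ 𝓝 (1 : K)) (hUD : ∀ h ∈ U, ∀ k, |D (k * h) - D k| ≤ ε) (k : K) :
    |D k - c| ≤ ε + (mK.real (interior U))⁻¹ * ∫ k', |D k' - c| ∂mK := by
  have hpos : 0 < mK.real (interior U) :=
    ENNReal.toReal_pos (isOpen_interior.measure_pos mK ⟨1, mem_interior_iff_mem_nhds.2 hU⟩).ne'
      (measure_ne_top _ _)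
  have hDm : Measurable fun k' => |D k' - c| := (hD.sub_const c).abs
  have hDi : Integrable (fun k' => |D k' - c|) mK :=
    Integrable.of_bound hDm.aestronglyMeasurable (M + |c|) (ae_of_all _ fun k' => by
      rw [Real.norm_eq_abs, abs_abs]
      exact (abs_sub _ _).trans (add_le_add (hM k') le_rfl))
  have hmul : MeasurePreserving (fun h => k * h) mK mK := measurePreserving_mul_left mK k
  have hDk : Integrable (fun h => |D (k * h) - c|) mK := hmul.integrable_comp_of_integrable hDi
  have h1 : ∫ _ in interior U, |D k - c| ∂mK ≤ ∫ h in interior U, (ε + |D (k * h) - c|) ∂mK := by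
    refine setIntegral_mono_on (integrable_const _).integrableOn
      ((integrable_const ε).add hDk).integrableOn isOpen_interior.measurableSet fun h hh => ?_
    have h2 := hUD h (interior_subset hh) k
    have h3 : |D k - c| ≤ |D (k * h) - D k| + |D (k * h) - c| := by
      have := abs_sub_le (D k) (D (k * h)) c
      rwa [abs_sub_comm (D k) (D (k * h))] at this
    linarith
  have h4 : ∫ h in interior U, |D (k * h) - c| ∂mK ≤ ∫ k', |D k' - c| ∂mK := by
    refine (setIntegral_le_integral hDk (ae_of_all _ fun h => abs_nonneg _)).trans (le_of_eq ?_)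
    exact integral_comp_measurePreserving hmul hDm.aestronglyMeasurable
  rw [integral_add (integrable_const ε).integrableOn hDk.integrableOn, setIntegral_const,
    setIntegral_const, smul_eq_mul, smul_eq_mul] at h1
  rw [← sub_le_iff_le_add', inv_mul_eq_div, le_div_iff₀ hpos]
  linarith

/-- If the walk on the base is equidistributed together with its future, and the skew product over
the compact extension is ergodic, then averages along the lifted walk converge. The averages over
blocks of length `L` are close to their limit in mean; equicontinuity along the compact fibres turns
this into a bound that is uniform along fibres, so that it can be tested on the base. -/
theorem tendsto_cesaro_skew_of_equidistributed (hact : Continuous fun p : E × X => act p.1 p.2)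
    (hτ : Continuous τ)
    (herg : Ergodic (skew (extAct act τ)) ((Measure.infinitePi fun _ => ν).prod (mX.prod mK)))
    {b : ℕ → E} {x : X} (k₀ : K)
    (hb : Equidistributed (fun n => (orbit act b x n, fun i => b (i + n)))
      (mX.prod (Measure.infinitePi fun _ : ℕ => ν)))
    {H : (ℕ → E) × (X × K) → ℝ} (hc : Continuous H) {M : ℝ} (hM : ∀ w, |H w| ≤ M)
    (heq : RightEquicontinuous fun (q : (ℕ → E) × X) k => H (q.1, (q.2, k))) :
    Tendsto (cesaro fun n => H ((skew (extAct act τ))^[n] (b, (x, k₀)))) atTop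
      (𝓝 (∫ w, H w ∂((Measure.infinitePi fun _ => ν).prod (mX.prod mK)))) := by
  set β : Measure (ℕ → E) := Measure.infinitePi fun _ => ν with hβ
  set T := skew (extAct act τ) with hT
  set c := ∫ w, H w ∂(β.prod (mX.prod mK)) with hcdef
  have hM0 : 0 ≤ M := (abs_nonneg _).trans (hM (b, (x, k₀)))
  have hTc : Continuous T := continuous_skew (continuous_extAct hact hτ)
  refine tendsto_of_forall_approx fun ε hε => ?_
  obtain ⟨U, hU, hUH⟩ := heq (ε / 4) (by positivity)
  set u := mK.real (interior U) with hu
  have hpos : 0 < u :=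
    ENNReal.toReal_pos (isOpen_interior.measure_pos mK ⟨1, mem_interior_iff_mem_nhds.2 hU⟩).ne'
      (measure_ne_top _ _)
  have hmean := tendsto_integral_abs_cesaro_sub herg hc.measurable hM
  obtain ⟨L, hL, hL0⟩ := (((tendsto_order.1 hmean).2 (u * (ε / 4)) (by positivity)).and
    (eventually_ne_atTop 0)).exists
  set D : (ℕ → E) × (X × K) → ℝ := fun w => cesaro (fun l => H (T^[l] w)) L with hD
  have hDc : Continuous D :=
    (continuous_finsetSum _ fun l _ => hc.comp (hTc.iterate l)).const_mul _
  have hDM : ∀ w, |D w| ≤ M := fun w => abs_cesaro_le hM0 (fun n => hM _) L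
  have hDU : ∀ (c : ℕ → E) (y : X), ∀ h ∈ U, ∀ k, |D (c, (y, k * h)) - D (c, (y, k))| ≤ ε / 4 := by
    intro c y h hh k
    refine (abs_cesaro_sub_le (r := fun _ => ε / 4) (fun l => ?_) L).trans
      (cesaro_const _ hL0).le
    rw [hT, skew_iterate, skew_iterate]
    simp only [orbit_extAct_mul_right]
    exact hUH h hh (_, _) _
  set S : X × (ℕ → E) → ℝ := fun q => ∫ k, |D (q.2, (q.1, k)) - c| ∂mK with hS
  have hDcM : ∀ w, |(|D w - c|)| ≤ M + |c| := fun w => by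
    rw [abs_abs]
    exact (abs_sub _ _).trans (add_le_add (hDM w) le_rfl)
  have hSc : Continuous S := by
    refine continuous_of_dominated (bound := fun _ => M + |c|) (fun q => ?_)
      (fun q => ae_of_all _ fun k => hDcM _) (integrable_const _) (ae_of_all _ fun k => ?_)
    · have : Continuous fun k : K => |D (q.2, (q.1, k)) - c| := by fun_prop
      exact this.measurable.aestronglyMeasurable
    · fun_prop
  have hSM : ∀ q, |S q| ≤ M + |c| := fun q => by
    have := norm_integral_le_of_norm_le_const (μ := mK) (C := M + |c|)
      (f := fun k => |D (q.2, (q.1, k)) - c|) (ae_of_all _ fun k => hDcM _)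
    simpa using this
  have hSint : ∫ q, S q ∂(mX.prod β) < u * (ε / 4) := by
    refine lt_of_eq_of_lt ?_ hL
    have hint : Integrable (fun w => |D w - c|) (β.prod (mX.prod mK)) :=
      integrable_of_continuous_of_bound (by fun_prop) hDcM
    rw [integral_prod _ hint, integral_prod_symm _ (integrable_of_continuous_of_bound hSc hSM)]
    refine integral_congr_ae (ae_of_all _ fun c' => ?_)
    refine (integral_prod (fun z : X × K => |D (c', z) - c|) ?_).symm
    exact integrable_of_continuous_of_bound (by fun_prop) fun z => hDcM (c', z)
  have hpt : ∀ w : (ℕ → E) × (X × K), |D w - c| ≤ ε / 4 + u⁻¹ * S (w.2.1, w.1) := by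
    rintro ⟨c', y, k⟩
    have hm : Continuous fun k : K => D (c', (y, k)) := by fun_prop
    exact abs_sub_le_add_integral (mK := mK) hm.measurable (fun k => hDM _) hU
      (fun h hh k => hDU c' y h hh k) k
  have hSlim : Tendsto (cesaro fun n => ε / 4 + u⁻¹ * S (orbit act b x n, fun i => b (i + n))) atTop
      (𝓝 (ε / 4 + u⁻¹ * ∫ q, S q ∂(mX.prod β))) := by
    refine ((tendsto_cesaro_const (ε / 4)).add
      ((hb.tendsto_cesaro hSc hSM).const_mul u⁻¹)).congr fun N => ?_
    rw [← cesaro_const_mul, ← cesaro_add]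
  have hlt : ε / 4 + u⁻¹ * ∫ q, S q ∂(mX.prod β) < 3 * ε / 4 := by
    have : u⁻¹ * ∫ q, S q ∂(mX.prod β) < ε / 4 := by
      rw [inv_mul_eq_div, div_lt_iff₀ hpos, mul_comm]
      exact hSint
    linarith
  have hblock := tendsto_cesaro_block (a := fun n => H (T^[n] (b, (x, k₀)))) (fun n => hM _) hL0
  filter_upwards [(tendsto_order.1 hSlim).2 _ hlt,
    Metric.tendsto_nhds.1 hblock (ε / 4) (by positivity), eventually_ne_atTop 0] with N h1 h2 hN
  have h3 : ∀ n, |cesaro (fun l => H (T^[n + l] (b, (x, k₀)))) L - c| ≤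
      ε / 4 + u⁻¹ * S (orbit act b x n, fun i => b (i + n)) := by
    intro n
    have h4 := hpt (T^[n] (b, (x, k₀)))
    have h5 : D (T^[n] (b, (x, k₀))) = cesaro (fun l => H (T^[n + l] (b, (x, k₀)))) L := by
      simp only [hD, ← Function.iterate_add_apply, add_comm]
    rw [h5, hT, skew_iterate] at h4
    simpa only [orbit_extAct_fst] using h4
  have h6 := abs_cesaro_sub_le (b := fun _ => c) h3 N
  rw [cesaro_const c hN] at h6
  rw [Real.dist_eq, sub_zero] at h2
  have h7 := abs_add_le (cesaro (fun n => H (T^[n] (b, (x, k₀)))) N -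
    cesaro (fun n => cesaro (fun l => H (T^[n + l] (b, (x, k₀)))) L) N)
    (cesaro (fun n => cesaro (fun l => H (T^[n + l] (b, (x, k₀)))) L) N - c)
  rw [sub_add_sub_cancel] at h7
  linarith

end Extension


/-! ### Two-sided sequences and measurable observables -/

section TwoSided

lemma shift_iterate {E : Type*} (b : ℤ → E) (n : ℕ) : shift^[n] b = fun i => b (i + n) := by
  induction n with
  | zero => simp
  | succ n ih =>
    rw [Function.iterate_succ_apply', ih]
    ext i
    simp only [shift]
    congr 1
    push_cast
    ring

lemma measurePreserving_shift {E : Type*} [MeasurableSpace E] (ν : Measure E)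
    [IsProbabilityMeasure ν] : MeasurePreserving (shift (E := E))
      (Measure.infinitePi fun _ => ν) (Measure.infinitePi fun _ => ν) :=
  measurePreserving_comp_injective ν (add_left_injective (1 : ℤ))

lemma measurePreserving_future {E : Type*} [MeasurableSpace E] (ν : Measure E)
    [IsProbabilityMeasure ν] : MeasurePreserving (future (E := E))
      (Measure.infinitePi fun _ => ν) (Measure.infinitePi fun _ => ν) :=
  measurePreserving_comp_injective ν fun i j h => by simpa using h

variable {E : Type*} [TopologicalSpace E] [CompactSpace E] [T2Space E] [SecondCountableTopology E]
  [MeasurableSpace E] [BorelSpace E] {ν : Measure E} [IsProbabilityMeasure ν]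
  {X : Type*} [TopologicalSpace X]
  [SecondCountableTopology X] [MeasurableSpace X] [BorelSpace X]
  {mX : Measure X} [IsProbabilityMeasure mX] {act : E → X → X}
  {K : Type*} [Group K] [TopologicalSpace K] [IsTopologicalGroup K]
  [MeasurableSpace K] [BorelSpace K] {mK : Measure K} [mK.IsHaarMeasure] [IsProbabilityMeasure mK]
  {τ : E → K}

/-- Averages of products of a function of the lifted walk and a continuous function of the two-sided
sequence of letters. Up to a small error the latter depends on finitely many letters, and after a
shift in time these all lie in the future. -/
theorem tendsto_cesaro_mul_continuous (hact : Continuous fun p : E × X => act p.1 p.2)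
    (hmp : ∀ e, MeasurePreserving (extAct act τ e) (mX.prod mK) (mX.prod mK))
    (hτ : Continuous τ)
    (herg : Ergodic (skew (extAct act τ)) ((Measure.infinitePi fun _ => ν).prod (mX.prod mK)))
    {b : ℤ → E} {x : X} (k₀ : K)
    (hb : Equidistributed (fun n => (orbit act (future b) x n, fun i => future b (i + n)))
      (mX.prod (Measure.infinitePi fun _ : ℕ => ν)))
    {u : X × K → ℝ} (hu : Continuous u) {M : ℝ} (hM : ∀ z, |u z| ≤ M)
    (heq : RightEquicontinuous fun x k => u (x, k)) {V : (ℤ → E) → ℝ} (hV : Continuous V) :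
    Tendsto (cesaro fun n => u (orbit (extAct act τ) (future b) (x, k₀) n) * V (shift^[n] b)) atTop
      (𝓝 ((∫ z, u z ∂(mX.prod mK)) * ∫ c, V c ∂(Measure.infinitePi fun _ : ℤ => ν))) := by
  set β : Measure (ℕ → E) := Measure.infinitePi fun _ => ν with hβ
  set βZ : Measure (ℤ → E) := Measure.infinitePi fun _ => ν with hβZ
  set A := extAct act τ with hA
  have hM0 : 0 ≤ M := (abs_nonneg _).trans (hM (x, k₀))
  obtain ⟨M', hM'⟩ : ∃ M', ∀ c, |V c| ≤ M' := by
    obtain ⟨M', hM'⟩ := isCompact_univ.exists_bound_of_continuousOn hV.continuousOn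
    exact ⟨M', fun c => hM' c trivial⟩
  have hM'0 : 0 ≤ M' := (abs_nonneg _).trans (hM' b)
  have hAc : Continuous fun p : E × (X × K) => A p.1 p.2 := continuous_extAct hact hτ
  refine tendsto_of_forall_approx fun ε hε => ?_
  obtain ⟨s, hs⟩ := exists_finset_forall_eq_imp_abs_sub_le (Q := Unit)
    (h := fun w : Unit × (ℤ → E) => V w.2) (by fun_prop) (ε := ε / (4 * (M + 1))) (by positivity)
  have hs' : ∀ c c', (∀ i ∈ s, c i = c' i) → |V c - V c'| ≤ ε / (4 * (M + 1)) := hs ()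
  have hMε : M * (ε / (4 * (M + 1))) ≤ ε / 4 := by
    rw [mul_div_assoc', div_le_div_iff₀ (by positivity) (by positivity)]
    nlinarith
  set m := s.sup Int.natAbs
  -- The sequence with letters `c` at the places `≥ -m`; the other places do not matter.
  let J : (ℕ → E) → ℤ → E := fun c i => c (i + m).toNat
  have hJc : Continuous J := continuous_pi fun i => continuous_apply _
  have hJ : ∀ (c : ℤ → E), ∀ i ∈ s, J (future c) i = shift^[m + 1] c i := fun c i hi => by
    have h1 : i.natAbs ≤ m := Finset.le_sup (f := Int.natAbs) hi
    simp only [J, future, shift_iterate]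
    congr 1
    omega
  let H : (ℕ → E) × (X × K) → ℝ := fun w => u (orbit A w.1 w.2 (m + 1)) * V (J w.1)
  have hHc : Continuous H :=
    (hu.comp (continuous_orbit hAc (m + 1))).mul (hV.comp (hJc.comp continuous_fst))
  have hmulM : ∀ {a c : ℝ}, |a| ≤ M → |c| ≤ M' → |a * c| ≤ M * M' := fun {a c} ha hc => by
    rw [abs_mul]
    exact mul_le_mul ha hc (abs_nonneg _) hM0
  have hHeq : RightEquicontinuous fun (q : (ℕ → E) × X) k => H (q.1, (q.2, k)) := by
    intro δ hδ
    obtain ⟨U, hU, hUu⟩ := heq (δ / (M' + 1)) (by positivity)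
    refine ⟨U, hU, fun h hh q k => ?_⟩
    simp only [H, hA, orbit_extAct_mul_right]
    rw [← sub_mul, abs_mul]
    refine (mul_le_mul (hUu h hh _ _) (hM' _) (abs_nonneg _) (by positivity)).trans ?_
    rw [div_mul_eq_mul_div, div_le_iff₀ (by positivity)]
    nlinarith
  have hHlim := tendsto_cesaro_skew_of_equidistributed hact hτ herg k₀ hb hHc
    (fun w => hmulM (hM _) (hM' _)) hHeq
  have hHint : ∫ w, H w ∂(β.prod (mX.prod mK)) = (∫ z, u z ∂(mX.prod mK)) * ∫ c, V (J c) ∂β := by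
    rw [integral_prod _ (integrable_of_continuous_of_bound hHc fun w => hmulM (hM _) (hM' _)),
      ← integral_const_mul]
    refine integral_congr_ae (ae_of_all _ fun c => ?_)
    simp only [H]
    rw [integral_mul_const,
      integral_comp_measurePreserving (measurePreserving_orbit hmp c (m + 1))
        hu.measurable.aestronglyMeasurable]
  have hVint : |(∫ c, V (J c) ∂β) - ∫ c, V c ∂βZ| ≤ ε / (4 * (M + 1)) := by
    have hVJ : Continuous fun c => V (J c) := hV.comp hJc
    have hfc : Continuous (future (E := E)) := continuous_pi fun i => continuous_apply _
    have hsc : Continuous (shift (E := E)) := continuous_pi fun i => continuous_apply _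
    have e1 : ∫ c, V (J c) ∂β = ∫ c, V (J (future c)) ∂βZ :=
      (integral_comp_measurePreserving (measurePreserving_future ν)
        hVJ.measurable.aestronglyMeasurable).symm
    have e2 : ∫ c, V c ∂βZ = ∫ c, V (shift^[m + 1] c) ∂βZ :=
      (integral_comp_measurePreserving ((measurePreserving_shift ν).iterate (m + 1))
        hV.measurable.aestronglyMeasurable).symm
    have i1 : Integrable (fun c => V (J (future c))) βZ :=
      integrable_of_continuous_of_bound (hVJ.comp hfc) fun c => hM' _
    have i2 : Integrable (fun c => V (shift^[m + 1] c)) βZ :=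
      integrable_of_continuous_of_bound (hV.comp (hsc.iterate (m + 1))) fun c => hM' _
    rw [e1, e2, ← integral_sub i1 i2]
    have := norm_integral_le_of_norm_le_const (μ := βZ) (C := ε / (4 * (M + 1)))
      (f := fun c => V (J (future c)) - V (shift^[m + 1] c))
      (ae_of_all _ fun c => hs' _ _ (hJ c))
    simpa using this
  set a : ℕ → ℝ := fun n => u (orbit A (future b) (x, k₀) n) * V (shift^[n] b) with ha
  have hshift := tendsto_cesaro_shift (a := a) (fun n => hmulM (hM _) (hM' _)) (m + 1)
  have hclose : ∀ n, |a (n + (m + 1)) - H ((skew A)^[n] (future b, (x, k₀)))| ≤ ε / 4 := by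
    intro n
    have e1 : orbit A (fun i => future b (i + n)) (orbit A (future b) (x, k₀) n) (m + 1)
        = orbit A (future b) (x, k₀) (n + (m + 1)) := orbit_orbit _ _ _ _
    have e2 : (fun i => future b (i + n)) = future (shift^[n] b) := by
      ext i
      simp only [future, shift_iterate]
      congr 1
      push_cast
      ring
    have e3 : shift^[n + (m + 1)] b = shift^[m + 1] (shift^[n] b) := by
      rw [← Function.iterate_add_apply, add_comm]
    simp only [ha, H, skew_iterate, e1]
    rw [← mul_sub, abs_mul, e2, e3, abs_sub_comm]
    refine le_trans (mul_le_mul (hM _) (hs' _ _ (hJ _)) (abs_nonneg _) hM0) hMε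
  rw [hHint] at hHlim
  filter_upwards [Metric.tendsto_nhds.1 hHlim (ε / 4) (by positivity),
    Metric.tendsto_nhds.1 hshift (ε / 4) (by positivity), eventually_ne_atTop 0] with N h1 h2 hN
  have h3 := abs_cesaro_sub_le (r := fun _ => ε / 4) hclose N
  rw [cesaro_const _ hN] at h3
  rw [Real.dist_eq] at h1 h2
  rw [sub_zero] at h2
  have huM : |∫ z, u z ∂(mX.prod mK)| ≤ M := by
    have := norm_integral_le_of_norm_le_const (μ := mX.prod mK) (C := M) (f := u) (ae_of_all _ hM)
    simpa using this
  have h4 : |(∫ z, u z ∂(mX.prod mK)) * (∫ c, V (J c) ∂β) -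
      (∫ z, u z ∂(mX.prod mK)) * ∫ c, V c ∂βZ| ≤ ε / 4 := by
    rw [← mul_sub, abs_mul]
    exact (mul_le_mul huM hVint (abs_nonneg _) hM0).trans hMε
  rw [abs_le] at *
  rw [abs_lt] at h1 h2
  constructor <;> linarith [h1.1, h1.2, h2.1, h2.2, h3.1, h3.2, h4.1, h4.2]

/-- Averages of products of a function of the lifted walk and a bounded measurable function of the
two-sided sequence that is continuous on large compact sets, provided that the complements of these
sets are visited rarely. -/
theorem tendsto_cesaro_mul_measurable (hact : Continuous fun p : E × X => act p.1 p.2)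
    (hmp : ∀ e, MeasurePreserving (extAct act τ e) (mX.prod mK) (mX.prod mK))
    (hτ : Continuous τ)
    (herg : Ergodic (skew (extAct act τ)) ((Measure.infinitePi fun _ => ν).prod (mX.prod mK)))
    {b : ℤ → E} {x : X} (k₀ : K)
    (hb : Equidistributed (fun n => (orbit act (future b) x n, fun i => future b (i + n)))
      (mX.prod (Measure.infinitePi fun _ : ℕ => ν)))
    {C : ℕ → Set (ℤ → E)} (hC : ∀ j, IsCompact (C j))
    (hCm : ∀ j, (Measure.infinitePi fun _ : ℤ => ν) (C j)ᶜ ≤ ENNReal.ofReal ((1 / 4) ^ j))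
    (hCb : ∀ᶠ j in atTop, ∀ N, cesaro (fun n => (C j)ᶜ.indicator 1 (shift^[n] b)) N ≤ (1 / 2) ^ j)
    {u : X × K → ℝ} (hu : Continuous u) {M : ℝ} (hM : ∀ z, |u z| ≤ M)
    (heq : RightEquicontinuous fun x k => u (x, k)) {v : (ℤ → E) → ℝ}
    (hvc : ∀ j, ContinuousOn v (C j)) {M' : ℝ} (hM' : ∀ c, |v c| ≤ M') :
    Tendsto (cesaro fun n => u (orbit (extAct act τ) (future b) (x, k₀) n) * v (shift^[n] b)) atTop
      (𝓝 ((∫ z, u z ∂(mX.prod mK)) * ∫ c, v c ∂(Measure.infinitePi fun _ : ℤ => ν))) := by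
  set βZ : Measure (ℤ → E) := Measure.infinitePi fun _ => ν with hβZ
  have hM0 : 0 ≤ M := (abs_nonneg _).trans (hM (x, k₀))
  have hM'0 : 0 ≤ M' := (abs_nonneg _).trans (hM' b)
  rw [← integral_prod_mul]
  refine (tendsto_cesaro_of_approx (P := (mX.prod mK).prod βZ)
    (φ := fun q => u q.1 * v q.2)
    (w := fun n => (orbit (extAct act τ) (future b) (x, k₀) n, shift^[n] b)) fun ε hε => ?_).2
  have hpow : Tendsto (fun j : ℕ => 2 * (M * M') * (1 / 2 : ℝ) ^ j) atTop (𝓝 0) := by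
    simpa using (tendsto_pow_atTop_nhds_zero_of_lt_one (by norm_num : (0 : ℝ) ≤ 1 / 2)
      (by norm_num)).const_mul (2 * (M * M'))
  obtain ⟨j, hj, hjε⟩ := (hCb.and ((tendsto_order.1 hpow).2 ε hε)).exists
  have hCcl := (hC j).isClosed
  have hCms : MeasurableSet (C j)ᶜ := hCcl.measurableSet.compl
  -- By Tietze's theorem, `v` agrees on `C j` with a continuous function of the same bound.
  obtain ⟨V, hVM, hVv⟩ : ∃ V : C(ℤ → E, ℝ), (∀ c, V c ∈ Set.Icc (-M') M') ∧
      (V : (ℤ → E) → ℝ) ∘ Subtype.val = fun c : C j => v c := by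
    have := ContinuousMap.exists_extension_forall_mem_of_isClosedEmbedding
      (⟨fun c : C j => v c, (hvc j).domRestrict⟩ : C(C j, ℝ)) (t := Set.Icc (-M') M')
      (fun c => abs_le.1 (hM' c)) ⟨0, by simpa using hM'0⟩ hCcl.isClosedEmbedding_subtypeVal
    exact this
  have hVM' : ∀ c, |V c| ≤ M' := fun c => abs_le.2 (hVM c)
  have hint : Integrable (fun c => 2 * (M * M') * (C j)ᶜ.indicator (1 : (ℤ → E) → ℝ) c) βZ :=
    ((integrable_const (1 : ℝ)).indicator hCms).const_mul _
  refine ⟨fun q => u q.1 * V q.2, fun q => 2 * (M * M') * (C j)ᶜ.indicator 1 q.2, fun q => ?_,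
    integrable_of_continuous_of_bound (by fun_prop) (M := M * M') fun q => ?_,
    hint.comp_snd (mX.prod mK), ?_, ?_, ?_⟩
  · change |u q.1 * v q.2 - u q.1 * V q.2| ≤
      2 * (M * M') * (C j)ᶜ.indicator (1 : (ℤ → E) → ℝ) q.2
    by_cases hq : q.2 ∈ C j
    · have : V q.2 = v q.2 := congrFun hVv ⟨q.2, hq⟩
      rw [this, sub_self, abs_zero, Set.indicator_of_notMem (Set.notMem_compl_iff.2 hq), mul_zero]
    · rw [Set.indicator_of_mem (show q.2 ∈ (C j)ᶜ from hq), Pi.one_apply, mul_one, ← mul_sub,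
        abs_mul]
      have : |v q.2 - V q.2| ≤ 2 * M' :=
        (abs_sub _ _).trans (by linarith [hM' q.2, hVM' q.2])
      refine (mul_le_mul (hM _) this (abs_nonneg _) hM0).trans (le_of_eq (by ring))
  · rw [abs_mul]
    exact mul_le_mul (hM _) (hVM' _) (abs_nonneg _) hM0
  · simp only
    rw [integral_prod_mul]
    exact tendsto_cesaro_mul_continuous hact hmp hτ herg k₀ hb hu hM heq V.continuous
  · refine Eventually.of_forall fun N => ?_
    simp only
    rw [cesaro_const_mul]
    exact (mul_le_mul_of_nonneg_left (hj N) (by positivity)).trans hjε.le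
  · rw [integral_fun_snd (fun c => 2 * (M * M') * (C j)ᶜ.indicator (1 : (ℤ → E) → ℝ) c),
      integral_const_mul, integral_indicator_one hCms]
    simp only [probReal_univ, one_smul]
    refine (mul_le_mul_of_nonneg_left (ENNReal.toReal_le_of_le_ofReal (by positivity) (hCm j))
      (by positivity)).trans ((mul_le_mul_of_nonneg_left ?_ (by positivity)).trans hjε.le)
    exact pow_le_pow_left₀ (by norm_num) (by norm_num) j

end TwoSided


/-! ### Joint equidistribution of the lifted walk and a factor of the shift -/

section Joint

lemma rightEquicontinuous_of_isCompact {W K : Type*} [TopologicalSpace W] [Group K]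
    [TopologicalSpace K] [IsTopologicalGroup K] [CompactSpace K] {u : W → K → ℝ}
    (hu : Continuous fun p : W × K => u p.1 p.2) {S : Set W} (hS : IsCompact S)
    (h0 : ∀ w ∉ S, ∀ k, u w k = 0) : RightEquicontinuous u := by
  intro ε hε
  have hev : ∀ᶠ h in 𝓝 (1 : K), ∀ p ∈ S ×ˢ (Set.univ : Set K),
      |u p.1 (p.2 * h) - u p.1 p.2| < ε := by
    refine (hS.prod isCompact_univ).eventually_forall_of_forall_eventually
      (P := fun h p => |u p.1 (p.2 * h) - u p.1 p.2| < ε) fun p _ => ?_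
    have h1 : Continuous fun z : K × (W × K) => u z.2.1 (z.2.2 * z.1) :=
      hu.comp (by fun_prop : Continuous fun z : K × (W × K) => (z.2.1, z.2.2 * z.1))
    have h2 : Continuous fun z : K × (W × K) => u z.2.1 z.2.2 :=
      hu.comp (by fun_prop : Continuous fun z : K × (W × K) => (z.2.1, z.2.2))
    have h12 : Continuous fun z : K × (W × K) => |u z.2.1 (z.2.2 * z.1) - u z.2.1 z.2.2| :=
      (h1.sub h2).abs
    have h3 := h12.tendsto ((1 : K), p)
    simp only [mul_one, sub_self, abs_zero] at h3
    exact (tendsto_order.1 h3).2 ε hε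
  refine ⟨_, hev, fun h hh w k => ?_⟩
  by_cases hw : w ∈ S
  · exact (hh (w, k) ⟨hw, trivial⟩).le
  · rw [h0 w hw, h0 w hw, sub_self, abs_zero]
    exact hε.le

/-- On a product of compact sets, a continuous function of two variables is approximated uniformly
by finite sums of products of functions of one variable, with a partition of unity as
coefficients. -/
lemma exists_finset_abs_sub_sum_le {W Y : Type*} [TopologicalSpace W] [MetricSpace Y]
    {φ : W × Y → ℝ} (hφ : Continuous φ) {S : Set W} (hS : IsCompact S) {F : Set Y}
    (hF : IsCompact F) {ε : ℝ} (hε : 0 < ε) :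
    ∃ (t : Finset Y) (ρ : t → C(Y, ℝ)), (∀ i y, 0 ≤ ρ i y) ∧ (∀ y, ∑ i, ρ i y ≤ 1) ∧
      ∀ w ∈ S, ∀ y ∈ F, |φ (w, y) - ∑ i : t, φ (w, i) * ρ i y| ≤ ε := by
  have : CompactSpace S := isCompact_iff_compactSpace.1 hS
  let g : C(Y, C(S, ℝ)) :=
    ContinuousMap.curry ⟨fun p : Y × S => φ (p.2, p.1), by fun_prop⟩
  let U : Y → Set Y := fun y => g ⁻¹' Metric.ball (g y) ε
  have hUo : ∀ y, IsOpen (U y) := fun y => Metric.isOpen_ball.preimage g.continuous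
  obtain ⟨t, -, ht⟩ := hF.elim_nhds_subcover U fun y _ =>
    (hUo y).mem_nhds (Metric.mem_ball_self hε)
  obtain ⟨ρ, hρ⟩ := PartitionOfUnity.exists_isSubordinate_of_locallyFinite hF.isClosed
    (fun i : t => U i) (fun i => hUo i) (locallyFinite_of_finite _)
    (by simpa [Set.iUnion_subtype] using ht)
  refine ⟨t, ρ, fun i y => ρ.nonneg i y, fun y => ?_, fun w hw y hy => ?_⟩
  · rw [← finsum_eq_sum_of_fintype]
    exact ρ.sum_le_one y
  · have h1 : ∑ i, ρ i y = 1 := by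
      rw [← finsum_eq_sum_of_fintype]
      exact ρ.sum_eq_one hy
    have e : φ (w, y) - ∑ i : t, φ (w, i) * ρ i y = ∑ i : t, (φ (w, y) - φ (w, i)) * ρ i y := by
      simp only [sub_mul, Finset.sum_sub_distrib, ← Finset.mul_sum, h1, mul_one]
    rw [e]
    calc |∑ i : t, (φ (w, y) - φ (w, i)) * ρ i y|
        ≤ ∑ i : t, |(φ (w, y) - φ (w, i)) * ρ i y| := Finset.abs_sum_le_sum_abs _ _
      _ ≤ ∑ i : t, ε * ρ i y := Finset.sum_le_sum fun i _ => by
          rw [abs_mul, abs_of_nonneg (ρ.nonneg i y)]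
          by_cases hi : ρ i y = 0
          · simp [hi]
          · refine mul_le_mul_of_nonneg_right ?_ (ρ.nonneg i y)
            have hmem : y ∈ U i := hρ i (subset_tsupport _ hi)
            have := (ContinuousMap.dist_apply_le_dist (⟨w, hw⟩ : S)).trans
              (Metric.mem_ball.1 hmem).le
            rwa [Real.dist_eq] at this
      _ = ε := by rw [← Finset.mul_sum, h1, mul_one]

lemma integral_prod_assoc_mul {X K Y : Type*} [MeasurableSpace X] [MeasurableSpace K]
    [MeasurableSpace Y] (mX : Measure X) (mK : Measure K) (mY : Measure Y)
    [SFinite mX] [SFinite mK] [SFinite mY] (u : X × K → ℝ) (v : Y → ℝ) :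
    ∫ p, u (p.1, p.2.1) * v p.2.2 ∂(mX.prod (mK.prod mY)) =
      (∫ z, u z ∂(mX.prod mK)) * ∫ y, v y ∂mY := by
  rw [← integral_prod_mul]
  exact ((measurePreserving_prodAssoc mX mK mY).integral_comp'
    (fun p => u (p.1, p.2.1) * v p.2.2)).symm

variable {E : Type*} [TopologicalSpace E] [CompactSpace E] [T2Space E] [SecondCountableTopology E]
  [MeasurableSpace E] [BorelSpace E] (ν : Measure E) [IsProbabilityMeasure ν]
  {X : Type*} [TopologicalSpace X] [T2Space X] [LocallyCompactSpace X]
  [SecondCountableTopology X] [MeasurableSpace X] [BorelSpace X]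
  {mX : Measure X} [IsProbabilityMeasure mX] {act : E → X → X}
  {K : Type*} [Group K] [TopologicalSpace K] [IsTopologicalGroup K] [CompactSpace K]
  [MeasurableSpace K] [BorelSpace K] {mK : Measure K} [mK.IsHaarMeasure] [IsProbabilityMeasure mK]
  {τ : E → K}
  {Y : Type*} [MetricSpace Y] [MeasurableSpace Y] [BorelSpace Y]

/-- If almost every trajectory of the walk on `X` is equidistributed and the skew product over the
compact extension is ergodic, then almost every trajectory of the lifted walk is equidistributed
jointly with any measurable function of the shifted sequence of letters. -/
theorem ae_equidistributed_orbit_extAct (hact : Continuous fun p : E × X => act p.1 p.2)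
    (hmp : ∀ e, MeasurePreserving (extAct act τ e) (mX.prod mK) (mX.prod mK))
    (hτ : Continuous τ)
    (herg : Ergodic (skew (extAct act τ)) ((Measure.infinitePi fun _ => ν).prod (mX.prod mK)))
    (x : X) (k₀ : K)
    (hx : ∀ᵐ b ∂(Measure.infinitePi fun _ : ℕ => ν), Equidistributed (orbit act b x) mX)
    {f : (ℤ → E) → Y} (hf : Measurable f) :
    ∀ᵐ b ∂(Measure.infinitePi fun _ : ℤ => ν),
      Equidistributed (fun n => ((orbit (extAct act τ) (future b) (x, k₀) n).1,
          (orbit (extAct act τ) (future b) (x, k₀) n).2, f (shift^[n] b)))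
        (mX.prod (mK.prod ((Measure.infinitePi fun _ : ℤ => ν).map f))) := by
  let _ : MetricSpace E := TopologicalSpace.metrizableSpaceMetric E
  set βZ : Measure (ℤ → E) := Measure.infinitePi fun _ => ν with hβZ
  set mY := βZ.map f with hmY
  have : IsProbabilityMeasure mY := Measure.isProbabilityMeasure_map hf.aemeasurable
  choose C hC hfC hCm using fun j : ℕ =>
    exists_isCompact_continuousOn βZ hf (δ := ENNReal.ofReal ((1 / 4) ^ j)) (by simp)
  filter_upwards [(measurePreserving_future ν).quasiMeasurePreserving.ae
    (ae_equidistributed_orbit_future ν hact x hx),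
    ae_eventually_forall_cesaro_indicator_le (measurePreserving_shift ν)
      (fun j => (hC j).measurableSet.compl) hCm] with b hb hCb φ
  set M := ‖φ‖ with hMdef
  have hM : ∀ p, |φ p| ≤ M := φ.norm_coe_le_norm
  have hM0 : 0 ≤ M := norm_nonneg φ
  refine (tendsto_cesaro_of_approx (P := mX.prod (mK.prod mY)) (φ := φ)
    (w := fun n => ((orbit (extAct act τ) (future b) (x, k₀) n).1,
      (orbit (extAct act τ) (future b) (x, k₀) n).2, f (shift^[n] b))) fun ε hε => ?_).2
  obtain ⟨χ, hχc, hχs, hχ0, hχ1, hχi⟩ :=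
    exists_cutoff mX (ε := ε / (8 * (M + 1))) (by positivity)
  have hχM : ∀ y, |χ y| ≤ 1 := fun y => by rw [abs_of_nonneg (hχ0 y)]; exact hχ1 y
  have hMχ : M * (1 - ∫ y, χ y ∂mX) ≤ ε / 8 := by
    have h1 : M * (1 - ∫ y, χ y ∂mX) ≤ M * (ε / (8 * (M + 1))) :=
      mul_le_mul_of_nonneg_left (by linarith) hM0
    refine h1.trans ?_
    rw [mul_div_assoc', div_le_div_iff₀ (by positivity) (by positivity)]
    nlinarith
  have hpow : Tendsto (fun j : ℕ => 2 * M * (1 / 2 : ℝ) ^ j) atTop (𝓝 0) := by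
    simpa using (tendsto_pow_atTop_nhds_zero_of_lt_one (by norm_num : (0 : ℝ) ≤ 1 / 2)
      (by norm_num)).const_mul (2 * M)
  obtain ⟨j, hj, hjε⟩ := (hCb.and ((tendsto_order.1 hpow).2 (ε / 4) (by positivity))).exists
  have hF : IsCompact (f '' C j) := (hC j).image_of_continuousOn (hfC j)
  set F := f '' C j with hFdef
  have hFm : MeasurableSet Fᶜ := hF.measurableSet.compl
  have hφ' : Continuous fun p : (X × K) × Y => φ (p.1.1, p.1.2, p.2) := by fun_prop
  obtain ⟨t, ρ, hρ0, hρ1, hρφ⟩ := exists_finset_abs_sub_sum_le hφ'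
    (hχs.isCompact.prod (isCompact_univ (X := K))) hF (ε := ε / 4) (by positivity)
  have hρM : ∀ i y, |ρ i y| ≤ 1 := fun i y => by
    rw [abs_of_nonneg (hρ0 i y)]
    exact (Finset.single_le_sum (fun i _ => hρ0 i y) (Finset.mem_univ i)).trans (hρ1 y)
  let u : t → X × K → ℝ := fun i z => χ z.1 * φ (z.1, z.2, i)
  have huc : ∀ i, Continuous (u i) := fun i => by fun_prop
  have huM : ∀ i z, |u i z| ≤ M := fun i z => by
    rw [abs_mul]
    exact (mul_le_of_le_one_left (abs_nonneg _) (hχM _)).trans (hM _)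
  have hueq : ∀ i, RightEquicontinuous fun x k => u i (x, k) := fun i =>
    rightEquicontinuous_of_isCompact (huc i) hχs.isCompact fun y hy k => by
      simp only [u, image_eq_zero_of_notMem_tsupport hy, zero_mul]
  have hui : ∀ i, Integrable (fun p : X × K × Y => u i (p.1, p.2.1) * ρ i p.2.2)
      (mX.prod (mK.prod mY)) := fun i => by
    have h1 : Measurable fun p : X × K × Y => u i (p.1, p.2.1) :=
      (huc i).measurable.comp (by fun_prop)
    have h2 : Measurable fun p : X × K × Y => ρ i p.2.2 :=
      (ρ i).continuous.measurable.comp (by fun_prop)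
    refine Integrable.of_bound (h1.mul h2).aestronglyMeasurable (M * 1) (ae_of_all _ fun p => ?_)
    rw [Real.norm_eq_abs, abs_mul]
    exact mul_le_mul (huM i _) (hρM i _) (abs_nonneg _) hM0
  -- The three parts of the error: on the good compact set, off it, and far out in `X`.
  let r₂ : Y → ℝ := fun y => 2 * M * Fᶜ.indicator 1 y
  let r₃ : X → ℝ := fun y => M * (1 - χ y)
  have hr₂0 : ∀ y, 0 ≤ r₂ y := fun y =>
    mul_nonneg (by positivity) (Set.indicator_nonneg (fun _ _ => zero_le_one) _)
  have hr₃0 : ∀ y, 0 ≤ r₃ y := fun y => mul_nonneg hM0 (by linarith [hχ1 y])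
  have hi₂ : Integrable r₂ mY := ((integrable_const (1 : ℝ)).indicator hFm).const_mul _
  have hχint : Integrable χ mX := integrable_of_continuous_of_bound hχc hχM
  have hi₃ : Integrable r₃ mX := ((integrable_const (1 : ℝ)).sub hχint).const_mul _
  have hp₂ : MeasurePreserving (fun p : X × K × Y => p.2.2) (mX.prod (mK.prod mY)) mY :=
    measurePreserving_snd.comp measurePreserving_snd
  have hp₃ : MeasurePreserving (fun p : X × K × Y => p.1) (mX.prod (mK.prod mY)) mX :=
    measurePreserving_fst
  have hi₂' : Integrable (fun p : X × K × Y => r₂ p.2.2) (mX.prod (mK.prod mY)) :=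
    hp₂.integrable_comp_of_integrable hi₂
  have hi₃' : Integrable (fun p : X × K × Y => r₃ p.1) (mX.prod (mK.prod mY)) :=
    hp₃.integrable_comp_of_integrable hi₃
  refine ⟨fun p => ∑ i, u i (p.1, p.2.1) * ρ i p.2.2, fun p => ε / 4 + r₂ p.2.2 + r₃ p.1,
    fun p => ?_, integrable_finsetSum _ fun i _ => hui i,
    ((integrable_const (ε / 4)).add hi₂').add hi₃', ?_, ?_, ?_⟩
  · obtain ⟨y, k, z⟩ := p
    have e : φ (y, k, z) - ∑ i, u i (y, k) * ρ i z =
        χ y * (φ (y, k, z) - ∑ i : t, φ (y, k, i) * ρ i z) + φ (y, k, z) * (1 - χ y) := by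
      simp only [u, mul_sub, Finset.mul_sum, mul_assoc]
      ring
    change |φ (y, k, z) - ∑ i, u i (y, k) * ρ i z| ≤ ε / 4 + r₂ z + r₃ y
    rw [e]
    refine (abs_add_le _ _).trans (add_le_add ?_ ?_)
    · by_cases hy : y ∈ tsupport χ
      · rw [abs_mul]
        refine (mul_le_of_le_one_left (abs_nonneg _) (hχM _)).trans ?_
        by_cases hz : z ∈ F
        · exact (hρφ (y, k) ⟨hy, trivial⟩ z hz).trans (le_add_of_nonneg_right (hr₂0 z))
        · have h1 : |∑ i : t, φ (y, k, i) * ρ i z| ≤ M := by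
            refine (Finset.abs_sum_le_sum_abs _ _).trans ?_
            calc ∑ i : t, |φ (y, k, i) * ρ i z| ≤ ∑ i, M * ρ i z :=
                  Finset.sum_le_sum fun i _ => by
                    rw [abs_mul, abs_of_nonneg (hρ0 i z)]
                    exact mul_le_mul_of_nonneg_right (hM _) (hρ0 i z)
              _ ≤ M := by
                  rw [← Finset.mul_sum]
                  exact mul_le_of_le_one_right hM0 (hρ1 z)
          have h2 : r₂ z = 2 * M := by
            simp only [r₂]
            rw [Set.indicator_of_mem (show z ∈ Fᶜ from hz), Pi.one_apply, mul_one]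
          rw [h2]
          exact (abs_sub _ _).trans (by linarith [hM (y, k, z)])
      · rw [image_eq_zero_of_notMem_tsupport hy, zero_mul, abs_zero]
        exact add_nonneg (by positivity) (hr₂0 z)
    · rw [abs_mul, abs_of_nonneg (by linarith [hχ1 y] : 0 ≤ 1 - χ y)]
      exact mul_le_mul_of_nonneg_right (hM _) (by linarith [hχ1 y])
  · rw [integral_finsetSum _ fun i _ => hui i]
    simp only [integral_prod_assoc_mul]
    refine (tendsto_finsetSum _ fun i _ => ?_).congr fun N => (cesaro_sum _ _ _).symm
    rw [hmY, integral_map hf.aemeasurable (ρ i).continuous.measurable.aestronglyMeasurable]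
    exact tendsto_cesaro_mul_measurable hact hmp hτ herg k₀ hb hC hCm hCb (huc i) (huM i) (hueq i)
      (v := fun c => ρ i (f c)) (fun j => (ρ i).continuous.comp_continuousOn (hfC j))
      fun c => hρM i _
  · have hb' := hb.tendsto_cesaro (φ := fun q => χ q.1) (hχc.comp continuous_fst)
      (fun q => hχM q.1)
    rw [integral_comp_measurePreserving measurePreserving_fst
      hχc.measurable.aestronglyMeasurable] at hb'
    have h3 : Tendsto (cesaro fun n => r₃ (orbit act (future b) x n)) atTop
        (𝓝 (M * (1 - ∫ y, χ y ∂mX))) := by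
      refine (((tendsto_cesaro_const 1).sub hb').const_mul M).congr fun N => ?_
      rw [← cesaro_sub, ← cesaro_const_mul]
    filter_upwards [(tendsto_order.1 h3).2 (ε / 4) (by linarith), eventually_ne_atTop 0]
      with N hN hN0
    have h2 : cesaro (fun n => r₂ (f (shift^[n] b))) N ≤ ε / 4 := by
      simp only [r₂]
      rw [cesaro_const_mul]
      refine (mul_le_mul_of_nonneg_left ((cesaro_mono (fun n => ?_) N).trans (hj N))
        (by positivity)).trans hjε.le
      by_cases hn : shift^[n] b ∈ C j
      · rw [Set.indicator_of_notMem (Set.notMem_compl_iff.2 (Set.mem_image_of_mem f hn))]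
        exact Set.indicator_nonneg (fun _ _ => zero_le_one) _
      · rw [Set.indicator_of_mem (show shift^[n] b ∈ (C j)ᶜ from hn)]
        exact Set.indicator_le_self' (fun _ _ => zero_le_one) _
    simp only [orbit_extAct_fst]
    rw [cesaro_add, cesaro_add, cesaro_const _ hN0]
    linarith
  · have hi₁₂ : Integrable (fun p : X × K × Y => ε / 4 + r₂ p.2.2) (mX.prod (mK.prod mY)) :=
      (integrable_const (ε / 4)).add hi₂'
    rw [integral_add hi₁₂ hi₃', integral_add (integrable_const (ε / 4)) hi₂',
      integral_comp_measurePreserving hp₂ hi₂.aestronglyMeasurable,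
      integral_comp_measurePreserving hp₃ hi₃.aestronglyMeasurable]
    have h3 : ∫ y, r₃ y ∂mX = M * (1 - ∫ y, χ y ∂mX) := by
      rw [integral_const_mul, integral_sub (integrable_const _) hχint]
      simp
    have h2 : ∫ y, r₂ y ∂mY ≤ ε / 4 := by
      rw [integral_const_mul, integral_indicator_one hFm]
      have h4 : mY Fᶜ ≤ ENNReal.ofReal ((1 / 4) ^ j) := by
        rw [hmY, Measure.map_apply hf hFm]
        exact (measure_mono fun c (hc : f c ∈ Fᶜ) hcj =>
          hc (Set.mem_image_of_mem f hcj)).trans (hCm j)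
      refine (mul_le_mul_of_nonneg_left (ENNReal.toReal_le_of_le_ofReal (by positivity) h4)
        (by positivity)).trans ((mul_le_mul_of_nonneg_left ?_ (by positivity)).trans hjε.le)
      exact pow_le_pow_left₀ (by norm_num) (by norm_num) j
    rw [h3]
    simp only [integral_const, probReal_univ, one_smul]
    linarith

end Joint


/-! ### Almost invariant sets -/

section Invariant

open scoped symmDiff

instance alphabetMeasure_isOpenPosMeasure {G : Type*} [Group G] [TopologicalSpace G]
    [MeasurableSpace G] [OpensMeasurableSpace G] [SecondCountableTopology G] (μ : Measure G) :
    (alphabetMeasure μ).IsOpenPosMeasure := by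
  refine ⟨fun U hU ⟨e, he⟩ h0 => ?_⟩
  obtain ⟨V, hV, rfl⟩ := isOpen_induced_iff.1 hU
  have hm : MeasurableSet μ.support := (Measure.isClosed_support (μ := μ)).measurableSet
  have hpos := (μ.mem_support_iff_forall e.1).1 e.2 V (hV.mem_nhds he)
  rw [alphabetMeasure, (MeasurableEmbedding.subtype_coe hm).comap_apply,
    Subtype.image_preimage_coe] at h0
  have h1 : μ V ≤ μ (μ.support ∩ V) + μ μ.supportᶜ := by
    refine (measure_mono fun y hy => ?_).trans (measure_union_le _ _)
    by_cases hy' : y ∈ μ.support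
    · exact Or.inl ⟨hy', hy⟩
    · exact Or.inr hy'
  rw [h0, Measure.measure_compl_support, add_zero] at h1
  exact hpos.ne' (le_antisymm h1 zero_le)

lemma measurePreserving_extAct {E X K : Type*} [MeasurableSpace X] {mX : Measure X} [SFinite mX]
    [Group K] [MeasurableSpace K] [MeasurableMul K] {mK : Measure K} [mK.IsMulLeftInvariant]
    [SFinite mK] {act : E → X → X} {τ : E → K} (hmp : ∀ e, MeasurePreserving (act e) mX mX)
    (e : E) : MeasurePreserving (extAct act τ e) (mX.prod mK) (mX.prod mK) :=
  (hmp e).prod (measurePreserving_mul_left mK (τ e))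

variable {E : Type*} [TopologicalSpace E]
  {X : Type*} [TopologicalSpace X] [T2Space X] [MeasurableSpace X] [BorelSpace X]
  {mX : Measure X} [IsProbabilityMeasure mX] [mX.InnerRegularCompactLTTop] {act : E → X → X}
  {K : Type*} [Group K] [TopologicalSpace K] [IsTopologicalGroup K]
  [MeasurableSpace K] [BorelSpace K] {mK : Measure K} [mK.IsHaarMeasure] [IsProbabilityMeasure mK]
  [mK.InnerRegularCompactLTTop] {τ : E → K}

/-- The preimages of a measurable set under the letters depend continuously, in measure, on the
letter. The group `K` need not be second countable, hence the reduction to rectangles. -/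
lemma tendsto_measureReal_symmDiff_preimage_extAct
    (hact : Continuous fun p : E × X => act p.1 p.2)
    (hmp : ∀ e, MeasurePreserving (act e) mX mX) (hτ : Continuous τ) {s : Set (X × K)}
    (hs : MeasurableSet s) (e₀ : E) :
    Tendsto (fun e => (mX.prod mK).real ((extAct act τ e ⁻¹' s) ∆ (extAct act τ e₀ ⁻¹' s))) (𝓝 e₀)
      (𝓝 0) := by
  set m := mX.prod mK with hm
  have hpre : ∀ e, MeasurePreserving (extAct act τ e) m m := measurePreserving_extAct hmp
  induction s, hs using MeasurableSpace.induction_on_inter generateFrom_prod.symm isPiSystem_prod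
    with
  | empty => simp
  | basic s hs =>
    obtain ⟨A, hA, B, hB, rfl⟩ := hs
    let F : C(E, C(X, X)) := ContinuousMap.curry ⟨fun p : E × X => act p.1 p.2, hact⟩
    let F' : C(E, C(K, K)) := ContinuousMap.curry ⟨fun p : E × K => τ p.1 * p.2, by fun_prop⟩
    have h1 := tendsto_measure_symmDiff_preimage_nhds_zero (F.continuous.tendsto e₀)
      (Eventually.of_forall hmp) (hmp e₀) (MeasurableSet.nullMeasurableSet hA) (measure_ne_top mX A)
    have h2 := tendsto_measure_symmDiff_preimage_nhds_zero (F'.continuous.tendsto e₀)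
      (Eventually.of_forall fun e => measurePreserving_mul_left mK (τ e))
      (measurePreserving_mul_left mK (τ e₀)) (MeasurableSet.nullMeasurableSet hB)
      (measure_ne_top mK B)
    have h3 := ((ENNReal.tendsto_toReal ENNReal.zero_ne_top).comp h1).add
      ((ENNReal.tendsto_toReal ENNReal.zero_ne_top).comp h2)
    simp only [ENNReal.toReal_zero, add_zero] at h3
    refine squeeze_zero (fun e => measureReal_nonneg) (fun e => ?_) h3
    have hsub : (extAct act τ e ⁻¹' (A ×ˢ B)) ∆ (extAct act τ e₀ ⁻¹' (A ×ˢ B)) ⊆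
        ((act e ⁻¹' A) ∆ (act e₀ ⁻¹' A)) ×ˢ (Set.univ : Set K) ∪
        (Set.univ : Set X) ×ˢ (((τ e * ·) ⁻¹' B) ∆ ((τ e₀ * ·) ⁻¹' B)) := by
      rintro ⟨y, k⟩ h
      simp only [Set.mem_symmDiff, Set.mem_preimage, extAct, Set.mem_prod, Set.mem_union,
        Set.mem_univ, and_true, true_and] at h ⊢
      tauto
    refine (measureReal_mono hsub).trans ((measureReal_union_le _ _).trans (le_of_eq ?_))
    rw [hm, measureReal_prod_prod, measureReal_prod_prod]
    simp only [probReal_univ, mul_one, one_mul]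
    rfl
  | compl s hs ih =>
    refine ih.congr fun e => ?_
    rw [Set.preimage_compl, Set.preimage_compl, compl_symmDiff_compl]
  | iUnion g hd hg ih =>
    have hsum : Summable fun n => 2 * m.real (g n) := by
      refine Summable.mul_left 2 (ENNReal.summable_toReal ?_)
      rw [← measure_iUnion hd hg]
      exact measure_ne_top _ _
    have hle : ∀ e n, m.real ((extAct act τ e ⁻¹' g n) ∆ (extAct act τ e₀ ⁻¹' g n)) ≤
        2 * m.real (g n) := fun e n => by
      have h1 : m.real (extAct act τ e ⁻¹' g n) = m.real (g n) :=
        (hpre e).measureReal_preimage (hg n).nullMeasurableSet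
      have h2 : m.real (extAct act τ e₀ ⁻¹' g n) = m.real (g n) :=
        (hpre e₀).measureReal_preimage (hg n).nullMeasurableSet
      have h3 := (measureReal_mono (μ := m) (symmDiff_le_sup (a := extAct act τ e ⁻¹' g n)
        (b := extAct act τ e₀ ⁻¹' g n))).trans (measureReal_union_le _ _)
      linarith
    have h1 := tendsto_tsum_of_dominated_convergence hsum ih
      (Eventually.of_forall fun e n => by
        rw [Real.norm_eq_abs, abs_of_nonneg measureReal_nonneg]; exact hle e n)
    rw [tsum_zero] at h1
    refine squeeze_zero (fun e => measureReal_nonneg) (fun e => ?_) h1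
    have hsub : (extAct act τ e ⁻¹' ⋃ n, g n) ∆ (extAct act τ e₀ ⁻¹' ⋃ n, g n) ⊆
        ⋃ n, (extAct act τ e ⁻¹' g n) ∆ (extAct act τ e₀ ⁻¹' g n) := by
      intro z hz
      simp only [Set.mem_symmDiff, Set.mem_preimage, Set.mem_iUnion] at hz ⊢
      rcases hz with ⟨⟨n, hn⟩, h⟩ | ⟨⟨n, hn⟩, h⟩
      · exact ⟨n, Or.inl ⟨hn, fun h' => h ⟨n, h'⟩⟩⟩
      · exact ⟨n, Or.inr ⟨hn, fun h' => h ⟨n, h'⟩⟩⟩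
    have hsum' := hsum.of_nonneg_of_le (fun n => measureReal_nonneg) (hle e)
    have h2 := (measure_mono (μ := m) hsub).trans (measure_iUnion_le _)
    rw [Measure.real, ← ENNReal.toReal_ofReal (tsum_nonneg fun n => measureReal_nonneg)]
    refine ENNReal.toReal_mono ENNReal.ofReal_ne_top (h2.trans (le_of_eq ?_))
    rw [ENNReal.ofReal_tsum_of_nonneg (fun n => measureReal_nonneg) hsum']
    exact tsum_congr fun n => (ofReal_measureReal (measure_ne_top _ _)).symm

/-- A set that is almost invariant under almost every letter is almost invariant under every letter
of the support. -/
lemma preimage_extAct_ae_eq [MeasurableSpace E] {ν : Measure E} [ν.IsOpenPosMeasure]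
    (hact : Continuous fun p : E × X => act p.1 p.2)
    (hmp : ∀ e, MeasurePreserving (act e) mX mX) (hτ : Continuous τ) {s : Set (X × K)}
    (hs : MeasurableSet s) (h : ∀ᵐ e ∂ν, extAct act τ e ⁻¹' s =ᵐ[mX.prod mK] s) (e₀ : E) :
    extAct act τ e₀ ⁻¹' s =ᵐ[mX.prod mK] s := by
  rw [← measure_symmDiff_eq_zero_iff, ← measureReal_eq_zero_iff]
  refine le_antisymm (le_of_forall_pos_le_add fun ε hε => ?_) measureReal_nonneg
  have hfreq := mem_closure_iff_frequently.1 (Measure.dense_of_ae h e₀)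
  obtain ⟨e, he, heε⟩ := (hfreq.and_eventually ((tendsto_order.1
    (tendsto_measureReal_symmDiff_preimage_extAct (mK := mK) hact hmp hτ hs e₀)).2 ε hε)).exists
  have he' : (mX.prod mK).real ((extAct act τ e ⁻¹' s) ∆ s) = 0 := by
    rw [measureReal_eq_zero_iff, measure_symmDiff_eq_zero_iff]
    exact he
  have htri := (measureReal_mono (μ := mX.prod mK)
    (symmDiff_triangle (extAct act τ e₀ ⁻¹' s) (extAct act τ e ⁻¹' s) s)).trans
    (measureReal_union_le _ _)
  rw [symmDiff_comm (extAct act τ e₀ ⁻¹' s) (extAct act τ e ⁻¹' s), he'] at htri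
  linarith

end Invariant


/-! ### The random walk on a homogeneous space -/

section Homogeneous

lemma polishSpace_of_locallyCompact_group (G : Type*) [Group G] [TopologicalSpace G]
    [IsTopologicalGroup G] [T2Space G] [SecondCountableTopology G] [LocallyCompactSpace G] :
    PolishSpace G := by
  let _ : UniformSpace G := IsTopologicalGroup.rightUniformSpace G
  have : IsRightUniformGroup G := ⟨rfl⟩
  have : CompleteSpace G := IsRightUniformGroup.completeSpace_of_weaklyLocallyCompactSpace
  have : (uniformity G).IsCountablyGenerated := by
    rw [uniformity_eq_comap_nhds_one']
    infer_instance
  infer_instance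

variable {G : Type*} [Group G] [MeasurableSpace G] {X K : Type*} [Group K]

lemma orbit_letter [TopologicalSpace G] [MulAction G X] (μ : Measure G)
    (κ : walkGroup μ →* K) (b : ℕ → Alphabet μ) (x : X) (n : ℕ) :
    orbit (extAct (fun (e : Alphabet μ) y => (e : G) • y) fun e => κ (letter μ e)) b (x, 1) n =
      ((walk μ b n : G) • x, κ (walk μ b n)) := by
  induction n with
  | zero => simp [orbit, walk]
  | succ n ih =>
    change extAct _ _ (b n) (orbit _ b (x, 1) n) = _
    rw [ih]
    simp [extAct, walk, letter, mul_smul]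

lemma orbit_letter_fst [TopologicalSpace G] [MulAction G X] (μ : Measure G)
    (b : ℕ → Alphabet μ) (x : X) (n : ℕ) :
    orbit (fun (e : Alphabet μ) y => (e : G) • y) b x n = (walk μ b n : G) • x := by
  induction n with
  | zero => simp [orbit, walk]
  | succ n ih => simp [orbit, walk, ih, letter, mul_smul]

variable [TopologicalSpace G] [MulAction G X] [MeasurableSpace X] [MeasurableConstSMul G X]
  {mX : Measure X} [SMulInvariantMeasure G X mX] [SFinite mX]
  [MeasurableSpace K] [MeasurableMul K] {mK : Measure K} [mK.IsMulLeftInvariant] [SFinite mK]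
  {μ : Measure G}

/-- A set that is almost invariant under the letters is almost invariant under the group that they
generate. -/
lemma preimage_skewAction_ae_eq (κ : walkGroup μ →* K) {s : Set (X × K)}
    (h : ∀ e : Alphabet μ, extAct (fun (e : Alphabet μ) y => (e : G) • y)
      (fun e => κ (letter μ e)) e ⁻¹' s =ᵐ[mX.prod mK] s) (γ : walkGroup μ) :
    (fun z : X × K => ((γ : G) • z.1, κ γ * z.2)) ⁻¹' s =ᵐ[mX.prod mK] s := by
  have hpre : ∀ γ : walkGroup μ, MeasurePreserving (fun z : X × K => ((γ : G) • z.1, κ γ * z.2))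
      (mX.prod mK) (mX.prod mK) := fun γ =>
    (measurePreserving_smul (γ : G) mX).prod (measurePreserving_mul_left mK (κ γ))
  obtain ⟨γ, hγ⟩ := γ
  induction hγ using Subgroup.closure_induction with
  | mem e he => exact h ⟨e, he⟩
  | one =>
    have h1 : (⟨1, one_mem _⟩ : walkGroup μ) = 1 := rfl
    simp only [h1, map_one, one_smul, one_mul]
    rfl
  | mul g g' hg hg' ih ih' =>
    have h1 := (hpre ⟨g', hg'⟩).quasiMeasurePreserving.preimage_ae_eq ih
    refine Filter.EventuallyEq.trans (Filter.EventuallyEq.of_eq ?_) (h1.trans ih')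
    rw [← Set.preimage_comp]
    congr 1
    ext z
    · simp [mul_smul]
    · have : (⟨g * g', mul_mem hg hg'⟩ : walkGroup μ) = ⟨g, hg⟩ * ⟨g', hg'⟩ := rfl
      simp only [this, map_mul, Function.comp, mul_assoc]
  | inv g hg ih =>
    have h1 := (hpre ⟨g⁻¹, inv_mem hg⟩).quasiMeasurePreserving.preimage_ae_eq ih
    refine h1.symm.trans (Filter.EventuallyEq.of_eq ?_)
    rw [← Set.preimage_comp]
    have : (⟨g⁻¹, inv_mem hg⟩ : walkGroup μ) = ⟨g, hg⟩⁻¹ := rfl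
    have hid : (fun z : X × K => ((g : G) • z.1, κ ⟨g, hg⟩ * z.2)) ∘
        (fun z : X × K => ((g⁻¹ : G) • z.1, κ ⟨g⁻¹, inv_mem hg⟩ * z.2)) = id := by
      ext z
      · simp
      · simp [this]
    exact (congrArg (· ⁻¹' s) hid).trans Set.preimage_id

end Homogeneous

section Walk

variable {G : Type*} [Group G] [TopologicalSpace G] [SecondCountableTopology G] [MeasurableSpace G]
  [BorelSpace G] {X : Type*} [TopologicalSpace X] [T2Space X] [LocallyCompactSpace X]
  [SecondCountableTopology X] [MeasurableSpace X] [BorelSpace X] [MulAction G X]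
  [ContinuousSMul G X] {mX : Measure X} [IsProbabilityMeasure mX] [SMulInvariantMeasure G X mX]
  {μ : Measure G} [IsProbabilityMeasure μ]
  {K : Type*} [Group K] [TopologicalSpace K] [IsTopologicalGroup K] [MeasurableSpace K]
  [BorelSpace K] {mK : Measure K} [mK.IsHaarMeasure] [mK.Regular] [IsProbabilityMeasure mK]
  {κ : walkGroup μ →* K}

lemma ergodic_skew_letter (hκ : Continuous fun e => κ (letter μ e))
    (herg : @ErgodicSMul (walkGroup μ) (X × K) (skewAction κ).toSMul _ (mX.prod mK)) :
    Ergodic (skew (extAct (fun (e : Alphabet μ) (y : X) => (e : G) • y) fun e => κ (letter μ e)))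
      ((Measure.infinitePi fun _ => alphabetMeasure μ).prod (mX.prod mK)) := by
  have hact : Continuous fun p : Alphabet μ × X => (p.1 : G) • p.2 := by fun_prop
  have hmp : ∀ e : Alphabet μ, MeasurePreserving (fun y : X => (e : G) • y) mX mX := fun e =>
    measurePreserving_smul (e : G) mX
  refine ergodic_skew (alphabetMeasure μ) (continuous_extAct hact hκ).measurable
    (measurePreserving_extAct hmp) fun s hs h => ?_
  exact herg.aeconst_of_forall_preimage_smul_ae_eq hs fun γ =>
    preimage_skewAction_ae_eq κ (preimage_extAct_ae_eq hact hmp hκ hs h) γ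

/-- Joint equidistribution for the walk generated by the support of `μ` on any space `X` with a
continuous, measure-preserving action. -/
theorem ae_equidistributed_walk [CompactSpace K] [CompactSpace (Alphabet μ)] [T2Space G] (x : X)
    (hx : ∀ᵐ b ∂(bernoulli μ), Equidistributed (fun n => (walk μ b n : G) • x) mX)
    (hκ : Continuous fun e => κ (letter μ e))
    (herg : @ErgodicSMul (walkGroup μ) (X × K) (skewAction κ).toSMul _ (mX.prod mK))
    {Y : Type*} [MetricSpace Y] [MeasurableSpace Y] [BorelSpace Y]
    {f : (ℤ → Alphabet μ) → Y} (hf : Measurable f) :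
    ∀ᵐ b ∂(biBernoulli μ),
      Equidistributed
        (fun n => ((walk μ (future b) n : G) • x, κ (walk μ (future b) n), f (shift^[n] b)))
        (mX.prod (mK.prod ((biBernoulli μ).map f))) := by
  have hact : Continuous fun p : Alphabet μ × X => (p.1 : G) • p.2 := by fun_prop
  have hmp : ∀ e : Alphabet μ, MeasurePreserving (fun y : X => (e : G) • y) mX mX := fun e =>
    measurePreserving_smul (e : G) mX
  have hx' : ∀ᵐ b ∂(Measure.infinitePi fun _ : ℕ => alphabetMeasure μ),
      Equidistributed (orbit (fun (e : Alphabet μ) (y : X) => (e : G) • y) b x) mX := by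
    filter_upwards [hx] with b hb
    rw [funext (orbit_letter_fst μ b x)]
    exact hb
  filter_upwards [ae_equidistributed_orbit_extAct (alphabetMeasure μ) hact
    (measurePreserving_extAct hmp) hκ (ergodic_skew_letter hκ herg) x 1 hx' hf] with b hb
  simp only [orbit_letter] at hb
  exact hb

end Walk

end RandomWalk

theorem mainTheorem4
    -- a connected unimodular (real, finite-dimensional) Lie group
    {V : Type*} [NormedAddCommGroup V] [NormedSpace ℝ V] [FiniteDimensional ℝ V]
    {G : Type*} [Group G] [TopologicalSpace G] [ChartedSpace V G] [LieGroup 𝓘(ℝ, V) ∞ G]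
    [IsTopologicalGroup G] [T2Space G] [SecondCountableTopology G] [ConnectedSpace G]
    [MeasurableSpace G] [BorelSpace G]
    (hG : RandomWalk.IsUnimodular G)
    -- a lattice and the invariant probability measure on the quotient
    (Λ : Subgroup G) (hΛ : RandomWalk.IsLattice Λ)
    (mX : Measure (G ⧸ Λ)) [IsProbabilityMeasure mX] [SMulInvariantMeasure G (G ⧸ Λ) mX]
    -- the step distribution
    (μ : Measure G) [IsProbabilityMeasure μ] (hμ : IsCompact μ.support)
    -- the starting point
    (x : G ⧸ Λ)
    (hx : ∀ᵐ b ∂(RandomWalk.bernoulli μ),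
      RandomWalk.Equidistributed (fun n => (RandomWalk.walk μ b n : G) • x) mX)
    -- a compact group with its Haar probability measure
    {K : Type*} [Group K] [TopologicalSpace K] [IsTopologicalGroup K] [CompactSpace K] [T2Space K]
    [MeasurableSpace K] [BorelSpace K]
    (mK : Measure K) [mK.IsHaarMeasure] [mK.Regular] [IsProbabilityMeasure mK]
    -- a homomorphism, continuous on the support of `μ`
    (κ : RandomWalk.walkGroup μ →* K) (hκ : Continuous fun e => κ (RandomWalk.letter μ e))
    (herg : @ErgodicSMul (RandomWalk.walkGroup μ) ((G ⧸ Λ) × K)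
      (RandomWalk.skewAction κ).toSMul _ (mX.prod mK))
    -- a measurable function of the two-sided sequence
    {Y : Type*} [MetricSpace Y] [LocallyCompactSpace Y] [MeasurableSpace Y] [BorelSpace Y]
    (f : (ℤ → RandomWalk.Alphabet μ) → Y) (hf : Measurable f) :
    ∀ᵐ b ∂(RandomWalk.biBernoulli μ),
      RandomWalk.Equidistributed
        (fun n => ((RandomWalk.walk μ (RandomWalk.future b) n : G) • x,
          κ (RandomWalk.walk μ (RandomWalk.future b) n), f (RandomWalk.shift^[n] b)))
        (mX.prod (mK.prod ((RandomWalk.biBernoulli μ).map f))) := by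
  have : LocallyCompactSpace G := Manifold.locallyCompact_of_finiteDimensional 𝓘(ℝ, V)
  have : PolishSpace G := RandomWalk.polishSpace_of_locallyCompact_group G
  have : DiscreteTopology Λ := hΛ.1
  have : IsClosed (Λ : Set G) := Subgroup.isClosed_of_discrete
  have : CompactSpace (RandomWalk.Alphabet μ) := isCompact_iff_compactSpace.1 hμ
  exact RandomWalk.ae_equidistributed_walk x hx hκ herg hf
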